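/- **Theorem.** An oriented graph is a digraph without loops and without pairs of opposite arcs. An oriented colouring of an oriented graph $D$ is a map $\beta$ on its vertices such that $\beta(u)\neq\beta(v)$ for every arc $(u,v)$, and for any two arcs $(t,u)$, $(v,w)$ one has $\beta(t)\ne\beta(w)$ or $\beta(u)\neq\beta(v)$. The oriented chromatic number of $D$ is the least number of colours in an oriented colouring of $D$; that of an undirected graph is the maximum over all its orientations; that of a family of undirected graphs is the maximum over its members. A Halin graph is a finite simple planar graph that has a planar embedding and an external face $F_0$ such that deleting the edges of $F_0$ gives a tree with at least three leaves whose leaves are exactly the vertices on $F_0$ (interior vertices of degree two are allowed). Let $T_7$ be the tournament on $\mathbb{Z}/7\mathbb{Z}$ in which $(i,j)$ is an arc if and only if $j-i\in\{1,2,4\}$. 1. Every orientation $D$ of a Halin graph has an oriented colouring with $8$ colours. Moreover, there is an oriented graph $H$ (which may depend on $D$) on the eight vertices $(\mathbb{Z}/7\mathbb{Z})\cup\{\infty\}$ that induces $T_7$ on $\mathbb{Z}/7\mathbb{Z}$, such that $D$ has a homomorphism to $H$. 2. There is an oriented Halin graph whose oriented chromatic number is equal to $8$. 3. Consequently, the oriented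 chromatic number of the family of Halin graphs is $8$. -/

import Mathlib

universe u

/-! ### Oriented graphs and their colourings -/

namespace Digraph

/-- A digraph is an oriented graph if it has no loops and no pair of opposite arcs. -/
def IsOriented {V : Type u} (D : Digraph V) : Prop :=
  ∀ v w, D.Adj v w → ¬ D.Adj w v

/-- `D` is an orientation of the simple graph `G`. -/
def IsOrientationOf {V : Type u} (D : Digraph V) (G : SimpleGraph V) : Prop :=
  D.IsOriented ∧ D.toSimpleGraphInclusive = G

/-- Oriented colourings: neighbours get different colours, and all arcs between two colour
classes point in the same direction. -/
def IsOrientedColoring {V : Type u} {C : Type*} (D : Digraph V) (β : V → C) : Prop :=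
  (∀ u v, D.Adj u v → β u ≠ β v) ∧
    ∀ t u v w, D.Adj t u → D.Adj v w → β t ≠ β w ∨ β u ≠ β v

/-- `D` has an oriented colouring with `k` colours. -/
def OrientedColorable {V : Type u} (D : Digraph V) (k : ℕ) : Prop :=
  ∃ β : V → Fin k, D.IsOrientedColoring β

/-- The oriented chromatic number of an oriented graph (`⊤` if no finite number of colours
suffices). -/
noncomputable def orientedChromaticNumber {V : Type u} (D : Digraph V) : ℕ∞ :=
  ⨅ (k : ℕ) (_ : D.OrientedColorable k), (k : ℕ∞)

/-- The quadratic-residue tournament `T₇` on `ℤ/7ℤ`: `(i, j)` is an arc iff `j - i` is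
`1`, `2` or `4`. -/
def T7 : Digraph (ZMod 7) where
  Adj i j := j - i = 1 ∨ j - i = 2 ∨ j - i = 4

end Digraph

namespace SimpleGraph

/-- The oriented chromatic number of a simple graph: the largest one of its orientations. -/
noncomputable def orientedChromaticNumber {V : Type u} (G : SimpleGraph V) : ℕ∞ :=
  ⨆ (D : Digraph V) (_ : D.IsOrientationOf G), D.orientedChromaticNumber

/-- The oriented chromatic number of a family of graphs: the largest one of its members. -/
noncomputable def familyOrientedChromaticNumber
    (P : ∀ {V : Type u}, SimpleGraph V → Prop) : ℕ∞ :=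
  ⨆ (V : Type u) (G : SimpleGraph V) (_ : P G), G.orientedChromaticNumber

/-! ### Embeddings in surfaces, as rotation systems, and Halin graphs -/

/-- A rotation system: a cyclic order of the darts leaving each vertex (`rot d` is the next dart
after `d` around the vertex `d.fst`). It describes a cellular embedding of a connected graph
in an oriented closed surface. -/
structure RotationSystem {V : Type u} (G : SimpleGraph V) where
  rot : Equiv.Perm G.Dart
  isCycleOn : ∀ v : V, rot.IsCycleOn {d : G.Dart | d.fst = v}

namespace RotationSystem

variable {V : Type u} {G : SimpleGraph V}

/-- The face-tracing permutation: follow a dart, then leave its endpoint along the dart that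
comes next, in the rotation there, after the reversed dart. -/
def facePerm (R : RotationSystem G) : Equiv.Perm G.Dart :=
  (Function.Involutive.toPerm Dart.symm Dart.symm_involutive).trans R.rot

/-- The faces of the embedding: the cycles of the face-tracing permutation. -/
def Face (R : RotationSystem G) : Type u :=
  Quotient (Equiv.Perm.SameCycle.setoid R.facePerm)

/-- The face whose boundary walk traverses the dart `d`. -/
def face (R : RotationSystem G) (d : G.Dart) : R.Face :=
  Quotient.mk (Equiv.Perm.SameCycle.setoid R.facePerm) d

/-- The edges on the boundary of a face. -/
def faceEdges (R : RotationSystem G) (F : R.Face) : Set (Sym2 V) :=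
  {e | ∃ d : G.Dart, R.face d = F ∧ d.edge = e}

/-- The vertices on the boundary of a face. -/
def faceVerts (R : RotationSystem G) (F : R.Face) : Set V :=
  {v | ∃ d : G.Dart, R.face d = F ∧ d.fst = v}

/-- The embedding of a finite connected graph (with at least one edge) is planar, that is, the
surface is the sphere: Euler's formula `|V| - |E| + |F| = 2`. Any face may then serve as the
external one. -/
def IsPlanar (R : RotationSystem G) : Prop :=
  G.Connected ∧ Nat.card V + Nat.card R.Face = Nat.card G.edgeSet + 2

end RotationSystem

/-- The leaves of a tree: its vertices of degree one. -/
def leaves {V : Type u} (T : SimpleGraph V) : Set V :=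
  {v | (T.neighborSet v).ncard = 1}

/-- A Halin graph: a finite graph with a planar embedding and a face `F₀` (the external one) such
that deleting the edges of `F₀` gives a tree with at least three leaves, the leaves being
exactly the vertices on `F₀`. -/
def IsHalin {V : Type u} (G : SimpleGraph V) : Prop :=
  Finite V ∧ ∃ R : RotationSystem G, R.IsPlanar ∧ ∃ F₀ : R.Face,
    (G.deleteEdges (R.faceEdges F₀)).IsTree ∧
    3 ≤ (G.deleteEdges (R.faceEdges F₀)).leaves.ncard ∧
    (G.deleteEdges (R.faceEdges F₀)).leaves = R.faceVerts F₀

end SimpleGraph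

/-!
Eight colours suffice. Let `T` be the tree of a Halin graph `G`, and let `D` be an orientation of
`G`. The colouring sends one vertex `y` of `D` to an additional colour `∞` and the others to `T₇`.
As the arcs between `∞` and the other colours are at our disposal, it suffices that the rest of
`D` is mapped to `T₇` in such a way that no in-neighbour of `y` has the colour of an out-neighbour
(`ColorableBut`, `ColorableBut.exists_hom`).

To colour a large part of `D`, one cuts it into pieces, each attached to the tree at a single
vertex `p` and meeting the external cycle in a path, from a leaf `l` to a leaf `m`. Multiplication
by a nonzero square is an automorphism of `T₇`, and so are the translations. Therefore it makes
sense to say that a piece has the type `(± 1, b)` if, relative to the colour of `p`, the leaves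
`l` and `m` can get the colours `± q` and `b * q`, for every nonzero square `q` (`HasType`). A
single leaf has such a type with `b = ± 1`. Two consecutive pieces at `p`, joined by an edge of
the external cycle, make up a piece that has a type with `b ≠ 0` again, and so does a piece at a
neighbour of `p`, when it is seen from `p`. Both are finite checks, over all directions of the
arcs (`Typed.append`, `Typed.lift`). By induction, every branch of the tree has a type
(`Frame.exists_typedPiece_branch`).

The vertex `y` is found near a hub `p`, a vertex with at least three neighbours all of whose
branches but one are threads, that is, paths to a leaf; a branch that is minimal among those that
are not threads provides one (`Frame.exists_hub`). A thread has the types of a leaf, so one finite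
check for the branches at `p` shows that the end of one of the two threads next to the exceptional
branch is suitable if this branch is not a leaf (`Frame.exists_colorableBut_of_inner`). What
remains, apart from the case of another neighbour of `p` taking the role of the exceptional one,
are the wheels: there the centre is suitable if it is a source or a sink, and so is a vertex that
is a source or a sink of the external cycle, while a directed external cycle is dealt with by a
finite check (`Frame.IsStar.exists_colorableBut`).

All this uses only the cyclic orders of the neighbours around the inner vertices and of the leaves
on the external cycle, and how they fit together (`Frame`). These are extracted from a planar
embedding as follows. Each face contains an edge of the external cycle, since otherwise its
boundary would be a closed walk in the tree that never turns back. By Euler's formula there is one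
more face than there are such edges; so each of them lies on the external face and on one inner
face, and each inner face contains only one of them (`IsHalinEmbedding.exists_outer_dart`). This
determines the rotation at the leaves, and the first leaf of a branch is found on the inner face
next to it (`IsHalinEmbedding.frame`).

Seven colours do not always suffice. In the example `exDigraph`, the tree consists of a directed
path with three vertices and of `26` leaves. Around the middle vertex of the path, directed paths
of leaves force seven different colours and two directed triangles among them, so that the colours
form one of `512` tournaments, up to isomorphism. For each of them, tracing the possible colours
of the leaves around the external cycle shows that they do not close up
(`exDigraph_not_colorable`).
-/

namespace HalinColoring

/-! ### An oriented Halin graph without an oriented colouring by seven colours -/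

/-- The spine vertex to which the leaf `i < 26` of the example is attached. -/
def exParent (i : ℕ) : ℕ :=
  if i < 9 then 26 else if i < 17 then 27 else if i < 25 then 28 else 27

/-- Whether the arc between a leaf of the example and its spine vertex points to the leaf. -/
def exOutward (i : ℕ) : Bool :=
  !([4, 5, 6, 7, 13, 14, 15, 16, 21, 22, 23, 24].contains i)

/-- Whether the arc between the leaves `i` and `i + 1` (modulo `26`) points to `i + 1`. -/
def exForward (i : ℕ) : Bool :=
  !([3, 12, 16, 20, 25].contains i)

/-- The arcs of the example on the vertices `0, …, 28`: the path `28 → 27 → 26` is the spine, the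
leaves `0, …, 25` are attached to it, and they form the external cycle in this order. -/
def exArc (u v : ℕ) : Bool :=
  (u == 27 && v == 26) || (u == 28 && v == 27) ||
    (Nat.blt v 26 && u == exParent v && exOutward v) ||
    (Nat.blt u 26 && v == exParent u && !exOutward u) ||
    (Nat.blt u 26 && Nat.blt v 26 &&
      ((v == (u + 1) % 26 && exForward u) || (u == (v + 1) % 26 && !exForward v)))

/-- The example as a digraph. -/
def exDigraph : Digraph (Fin 29) where
  Adj u v := exArc u v = true

instance exDigraph_decidableAdj : DecidableRel exDigraph.Adj := fun u v =>
  inferInstanceAs (Decidable (exArc u v = true))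

/-- The tournament on `0, …, 6` in which the out-neighbours of `0` are `1 → 2 → 3 → 1`, the
in-neighbours of `0` are `4 → 5 → 6 → 4`, and the nine arcs between these two triangles are given
by the binary digits of `b`. -/
def tour (b u v : ℕ) : Bool :=
  if u.beq 0 then (Nat.ble 1 v && Nat.ble v 3)
  else if v.beq 0 then Nat.ble 4 u
  else if u.ble 3 then
    (if v.ble 3 then ((u + 1) % 3).beq (v % 3) else !b.testBit (3 * (v - 4) + (u - 1)))
  else if v.ble 3 then b.testBit (3 * (u - 4) + (v - 1))
  else ((u + 1) % 3).beq (v % 3)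

/-- The colours in `tour b` which the leaf `i + 1` can have if the leaf `i` has a colour in `X` and
the spine vertices `26`, `27`, `28` have the colours `1`, `0`, `4`. -/
def colourStep (b i : ℕ) (X : List ℕ) : List ℕ :=
  let p := if exParent (i + 1) = 26 then 1 else if exParent (i + 1) = 27 then 0 else 4
  [0, 1, 2, 3, 4, 5, 6].filter fun w =>
    (bif exOutward (i + 1) then tour b p w else tour b w p) &&
      X.any fun v => bif exForward i then tour b v w else tour b w v

/-- The colours which the leaf `i + n` can have if the leaf `i` has a colour in `X`. -/
def colourWalk (b : ℕ) : ℕ → ℕ → List ℕ → List ℕ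
  | 0, _, X => X
  | n + 1, i, X =>
    match X with
    | [] => []
    | v :: X => colourWalk b n (i + 1) (colourStep b i (v :: X))

/-- Whichever way the nine arcs go, the colours cannot be continued around the external cycle:
for every colour `s` of the leaf `0` there is no colour left for the leaf `25`. -/
theorem colourWalk_not_closed : ∀ b < 512, ∀ s < 7, tour b 1 s = true →
    ((colourWalk b 25 0 [s]).all fun w => !tour b s w) = true := by
  decide +kernel

/-- `colourStep` keeps track of the colours of a homomorphism `γ` to `tour b`. -/
theorem mem_colourStep {b i : ℕ} {X : List ℕ} {γ : ℕ → ℕ} (hi : i < 25)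
    (h7 : ∀ u < 29, γ u < 7)
    (hγ : ∀ u v, u < 29 → v < 29 → exArc u v = true → tour b (γ u) (γ v) = true)
    (h26 : γ 26 = 1) (h27 : γ 27 = 0) (h28 : γ 28 = 4) (h : γ i ∈ X) :
    γ (i + 1) ∈ colourStep b i X := by
  have hw := h7 (i + 1) (by omega)
  have hp : (if exParent (i + 1) = 26 then 1 else if exParent (i + 1) = 27 then 0 else 4)
      = γ (exParent (i + 1)) := by
    unfold exParent
    split_ifs <;> simp_all
  have hplt : exParent (i + 1) < 29 := by
    unfold exParent
    split_ifs <;> simp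
  simp only [colourStep, List.mem_filter, hp]
  refine ⟨?_, ?_⟩
  · interval_cases γ (i + 1) <;> simp
  rw [Bool.and_eq_true, List.any_eq_true]
  refine ⟨?_, γ i, h, ?_⟩
  · cases ho : exOutward (i + 1)
    · exact hγ _ _ (by omega) hplt (by
        simp only [exArc, Bool.or_eq_true, Bool.and_eq_true, Nat.blt_eq, beq_self_eq_true, ho]
        refine Or.inl (Or.inr ⟨⟨by omega, trivial⟩, rfl⟩))
    · exact hγ _ _ hplt (by omega) (by
        simp only [exArc, Bool.or_eq_true, Bool.and_eq_true, Nat.blt_eq, beq_self_eq_true, ho]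
        refine Or.inl (Or.inl (Or.inr ⟨⟨by omega, trivial⟩, trivial⟩)))
  · have hm : (i + 1) % 26 = i + 1 := Nat.mod_eq_of_lt (by omega)
    cases ho : exForward i
    · exact hγ _ _ (by omega) (by omega) (by
        simp only [exArc, Bool.or_eq_true, Bool.and_eq_true, Nat.blt_eq, hm, beq_self_eq_true, ho]
        refine Or.inr ⟨⟨by omega, by omega⟩, Or.inr ⟨trivial, rfl⟩⟩)
    · exact hγ _ _ (by omega) (by omega) (by
        simp only [exArc, Bool.or_eq_true, Bool.and_eq_true, Nat.blt_eq, hm, beq_self_eq_true, ho]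
        refine Or.inr ⟨⟨by omega, by omega⟩, Or.inl ⟨trivial, trivial⟩⟩)

theorem mem_colourWalk {b : ℕ} {γ : ℕ → ℕ} (h7 : ∀ u < 29, γ u < 7)
    (hγ : ∀ u v, u < 29 → v < 29 → exArc u v = true → tour b (γ u) (γ v) = true)
    (h26 : γ 26 = 1) (h27 : γ 27 = 0) (h28 : γ 28 = 4) (n : ℕ) :
    ∀ (i : ℕ) (X : List ℕ), i + n ≤ 25 → γ i ∈ X → γ (i + n) ∈ colourWalk b n i X := by
  induction n with
  | zero => intro i X _ h; simpa [colourWalk] using h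
  | succ n ih =>
    intro i X hi h
    cases X with
    | nil => simp at h
    | cons v X =>
      have := ih (i + 1) _ (by omega) (mem_colourStep (by omega) h7 hγ h26 h27 h28 h)
      rw [show i + (n + 1) = i + 1 + n by omega]
      exact this

/-- The example has no homomorphism to `tour b` which maps the spine to `4 → 0 → 1`. -/
theorem no_hom_tour {b : ℕ} (hb : b < 512) {γ : ℕ → ℕ} (h7 : ∀ u < 29, γ u < 7)
    (hγ : ∀ u v, u < 29 → v < 29 → exArc u v = true → tour b (γ u) (γ v) = true)
    (h26 : γ 26 = 1) (h27 : γ 27 = 0) (h28 : γ 28 = 4) : False := by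
  have h0 := hγ 26 0 (by omega) (by omega) (by decide)
  rw [h26] at h0
  have h1 := colourWalk_not_closed b hb (γ 0) (h7 0 (by omega)) h0
  have h2 := mem_colourWalk h7 hγ h26 h27 h28 25 0 [γ 0] (by omega) (by simp)
  rw [List.all_eq_true] at h1
  have h3 := h1 _ h2
  have h4 := hγ 0 25 (by omega) (by omega) (by decide)
  simp [h4] at h3

/-- The vertex `27` and its neighbours `9 → 10 → 11` and `13 → 14 → 15` must have seven different
colours. As the directed paths `9, …, 12` and `13, …, 16` go on, the first three of these neighbours
have the colours of a directed triangle, and so have the last three. Hence the colours form a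
tournament `tour b`. -/
theorem exDigraph_not_colorable : ¬ exDigraph.OrientedColorable 7 := by
  rintro ⟨β, hβ₁, hβ₂⟩
  have ne : ∀ u v : Fin 29, exArc u v = true → β u ≠ β v := hβ₁
  -- two arcs which are opposite on the colours
  have op : ∀ t u v w : Fin 29, exArc t u = true → exArc v w = true → β t = β w → β u ≠ β v :=
    fun t u v w h₁ h₂ h₃ h₄ => (hβ₂ t u v w h₁ h₂).elim (fun h => h h₃) (fun h => h h₄)
  let g : Fin 7 → Fin 29 := ![27, 9, 10, 11, 13, 14, 15]
  -- two of these vertices are adjacent or joined by a directed path of length two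
  have hg : Function.Injective (β ∘ g) := by
    have h : ∀ i j : Fin 7, i < j → β (g i) ≠ β (g j) := by
      have hp : ∀ i : Fin 7, i ≠ 0 → β 27 ≠ β (g i) := by
        intro i hi
        by_cases h : exArc 27 (g i) = true
        · exact ne _ _ h
        · have : exArc (g i) 27 = true := by
            revert i; decide
          exact (ne _ _ this).symm
      have hpm : ∀ i j : Fin 29, exArc 27 i = true → exArc j 27 = true → β i ≠ β j :=
        fun i j h₁ h₂ => op 27 i j 27 h₁ h₂ rfl
      have h3 : ∀ i j k : Fin 29, exArc i j = true → exArc j k = true → β i ≠ β k :=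
        fun i j k h₁ h₂ h => op i j j k h₁ h₂ h rfl
      intro i j hij
      fin_cases i <;> fin_cases j <;> first
        | (exfalso; revert hij; decide)
        | exact hp _ (by decide)
        | exact hpm _ _ (by decide) (by decide)
        | exact ne _ _ (by decide)
        | exact h3 9 10 11 (by decide) (by decide)
        | exact h3 13 14 15 (by decide) (by decide)
    intro i j hij
    rcases lt_trichotomy i j with h' | h' | h'
    · exact absurd hij (h _ _ h')
    · exact h'
    · exact absurd hij.symm (h _ _ h')
  have hsurj : Function.Surjective (β ∘ g) := Finite.surjective_of_injective hg
  -- `A c c'`: some arc goes from the colour `c` to the colour `c'`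
  let A : Fin 7 → Fin 7 → Prop := fun c c' =>
    ∃ u v : Fin 29, exArc u v = true ∧ β u = c ∧ β v = c'
  have hA : ∀ u v : Fin 29, exArc u v = true → A (β u) (β v) := fun u v h => ⟨u, v, h, rfl, rfl⟩
  have hirr : ∀ c c', A c c' → c ≠ c' := by
    rintro _ _ ⟨u, v, h, rfl, rfl⟩
    exact ne u v h
  have htr : ∀ c c' c'', A c c' → A c' c'' → c ≠ c'' := by
    rintro _ _ _ ⟨u, v, h, rfl, rfl⟩ ⟨v', w, h', hv, rfl⟩ h2
    exact op u v v' w h h' h2 hv.symm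
  have hasymm : ∀ c c', A c c' → ¬ A c' c := fun c c' h h' => htr _ _ _ h h' rfl
  have hcol : ∀ v : Fin 29, ∃ i, β (g i) = β v := fun v => hsurj (β v)
  -- there is no other colour left for the last vertex of the path `9, …, 12`
  have h12 : β 12 = β 9 := by
    obtain ⟨i, hi⟩ := hcol 12
    have hp := hA 27 12 (by decide)
    have h1 := htr _ _ _ (hA 10 11 (by decide)) (hA 11 12 (by decide))
    have h2 := ne 11 12 (by decide)
    fin_cases i
    · exact absurd hi (ne 27 12 (by decide))
    · exact hi.symm
    · exact absurd hi h1
    · exact absurd hi h2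
    · exact absurd hi (htr _ _ _ (hA 13 27 (by decide)) hp)
    · exact absurd hi (htr _ _ _ (hA 14 27 (by decide)) hp)
    · exact absurd hi (htr _ _ _ (hA 15 27 (by decide)) hp)
  have h16 : β 16 = β 13 := by
    obtain ⟨i, hi⟩ := hcol 16
    have hp := hA 16 27 (by decide)
    have h1 := htr _ _ _ (hA 14 15 (by decide)) (hA 15 16 (by decide))
    have h2 := ne 15 16 (by decide)
    fin_cases i
    · exact absurd hi.symm (ne 16 27 (by decide))
    · exact absurd hi.symm (htr _ _ _ hp (hA 27 9 (by decide)))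
    · exact absurd hi.symm (htr _ _ _ hp (hA 27 10 (by decide)))
    · exact absurd hi.symm (htr _ _ _ hp (hA 27 11 (by decide)))
    · exact hi.symm
    · exact absurd hi h1
    · exact absurd hi h2
  have ha₁ := hA 9 10 (by decide)
  have ha₂ := hA 10 11 (by decide)
  have ha₃ : A (β 11) (β 9) := h12 ▸ hA 11 12 (by decide)
  have hb₁ := hA 13 14 (by decide)
  have hb₂ := hA 14 15 (by decide)
  have hb₃ : A (β 15) (β 13) := h16 ▸ hA 15 16 (by decide)
  -- the triangle of the colours of out-neighbours of `27`, starting with the colour of `26`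
  obtain ⟨x₁, x₂, x₃, h26, hx₁₂, hx₂₃, hx₃₁, hx₁, hx₂, hx₃⟩ : ∃ x₁ x₂ x₃, β 26 = x₁ ∧ A x₁ x₂ ∧
      A x₂ x₃ ∧ A x₃ x₁ ∧ A (β 27) x₁ ∧ A (β 27) x₂ ∧ A (β 27) x₃ := by
    have h9 := hA 27 9 (by decide)
    have h10 := hA 27 10 (by decide)
    have h11 := hA 27 11 (by decide)
    obtain ⟨i, hi⟩ := hcol 26
    have hp := hA 27 26 (by decide)
    fin_cases i
    · exact absurd hi (hirr _ _ hp)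
    · exact ⟨_, _, _, hi.symm, ha₁, ha₂, ha₃, h9, h10, h11⟩
    · exact ⟨_, _, _, hi.symm, ha₂, ha₃, ha₁, h10, h11, h9⟩
    · exact ⟨_, _, _, hi.symm, ha₃, ha₁, ha₂, h11, h9, h10⟩
    · exact absurd hi (htr _ _ _ (hA 13 27 (by decide)) hp)
    · exact absurd hi (htr _ _ _ (hA 14 27 (by decide)) hp)
    · exact absurd hi (htr _ _ _ (hA 15 27 (by decide)) hp)
  -- the triangle of the colours of in-neighbours of `27`, starting with the colour of `28`
  obtain ⟨y₁, y₂, y₃, h28, hy₁₂, hy₂₃, hy₃₁, hy₁, hy₂, hy₃⟩ : ∃ y₁ y₂ y₃, β 28 = y₁ ∧ A y₁ y₂ ∧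
      A y₂ y₃ ∧ A y₃ y₁ ∧ A y₁ (β 27) ∧ A y₂ (β 27) ∧ A y₃ (β 27) := by
    have h13 := hA 13 27 (by decide)
    have h14 := hA 14 27 (by decide)
    have h15 := hA 15 27 (by decide)
    obtain ⟨i, hi⟩ := hcol 28
    have hp := hA 28 27 (by decide)
    fin_cases i
    · exact absurd hi.symm (hirr _ _ hp)
    · exact absurd hi.symm (htr _ _ _ hp (hA 27 9 (by decide)))
    · exact absurd hi.symm (htr _ _ _ hp (hA 27 10 (by decide)))
    · exact absurd hi.symm (htr _ _ _ hp (hA 27 11 (by decide)))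
    · exact ⟨_, _, _, hi.symm, hb₁, hb₂, hb₃, h13, h14, h15⟩
    · exact ⟨_, _, _, hi.symm, hb₂, hb₃, hb₁, h14, h15, h13⟩
    · exact ⟨_, _, _, hi.symm, hb₃, hb₁, hb₂, h15, h13, h14⟩
  classical
  let x : ℕ → Fin 7 := fun i => if i = 0 then x₁ else if i = 1 then x₂ else x₃
  let y : ℕ → Fin 7 := fun i => if i = 0 then y₁ else if i = 1 then y₂ else y₃
  -- where no arc joins two colours, the digit of `b` is irrelevant
  let b : ℕ := Nat.ofBits fun k : Fin 9 => decide (A (y (k / 3)) (x (k % 3)))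
  let e : Fin 7 → Fin 7 := ![β 27, x₁, x₂, x₃, y₁, y₂, y₃]
  have hbit : ∀ j < 3, ∀ i < 3, b.testBit (3 * j + i) = decide (A (y j) (x i)) := by
    intro j hj i hi
    rw [Nat.testBit_ofBits_lt _ _ (by omega)]
    simp only [show (3 * j + i) / 3 = j by omega, show (3 * j + i) % 3 = i by omega]
  have hyx : ∀ j < 3, ∀ i < 3, A (y j) (x i) → tour b (j + 4) (i + 1) = true := by
    intro j hj i hi h
    have := hbit j hj i hi
    rw [decide_eq_true h] at this
    interval_cases j <;> interval_cases i <;> simpa [tour] using this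
  have hxy : ∀ j < 3, ∀ i < 3, A (x i) (y j) → tour b (i + 1) (j + 4) = true := by
    intro j hj i hi h
    have := hbit j hj i hi
    rw [decide_eq_false (hasymm _ _ h)] at this
    interval_cases j <;> interval_cases i <;> simpa [tour] using this
  have hb : b < 512 := Nat.ofBits_lt_two_pow _
  clear_value b
  have he : ∀ i j : Fin 7, A (e i) (e j) → tour b i j = true := by
    intro i j h
    fin_cases i <;> fin_cases j <;> first
      | (simp [tour]; done)
      | exact absurd rfl (hirr _ _ h)
      | exact absurd h (hasymm _ _ (by assumption))
      | exact hxy _ (by decide : 0 < 3) _ (by decide : 0 < 3) h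
      | exact hxy _ (by decide : 1 < 3) _ (by decide : 0 < 3) h
      | exact hxy _ (by decide : 2 < 3) _ (by decide : 0 < 3) h
      | exact hxy _ (by decide : 0 < 3) _ (by decide : 1 < 3) h
      | exact hxy _ (by decide : 1 < 3) _ (by decide : 1 < 3) h
      | exact hxy _ (by decide : 2 < 3) _ (by decide : 1 < 3) h
      | exact hxy _ (by decide : 0 < 3) _ (by decide : 2 < 3) h
      | exact hxy _ (by decide : 1 < 3) _ (by decide : 2 < 3) h
      | exact hxy _ (by decide : 2 < 3) _ (by decide : 2 < 3) h
      | exact hyx _ (by decide : 0 < 3) _ (by decide : 0 < 3) h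
      | exact hyx _ (by decide : 1 < 3) _ (by decide : 0 < 3) h
      | exact hyx _ (by decide : 2 < 3) _ (by decide : 0 < 3) h
      | exact hyx _ (by decide : 0 < 3) _ (by decide : 1 < 3) h
      | exact hyx _ (by decide : 1 < 3) _ (by decide : 1 < 3) h
      | exact hyx _ (by decide : 2 < 3) _ (by decide : 1 < 3) h
      | exact hyx _ (by decide : 0 < 3) _ (by decide : 2 < 3) h
      | exact hyx _ (by decide : 1 < 3) _ (by decide : 2 < 3) h
      | exact hyx _ (by decide : 2 < 3) _ (by decide : 2 < 3) h
  have hinj : Function.Injective e := by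
    have h : ∀ i j : Fin 7, i < j → e i ≠ e j := by
      have hyx : ∀ u v, A u (β 27) → A (β 27) v → v ≠ u := fun u v h h' => (htr _ _ _ h h').symm
      intro i j hij
      fin_cases i <;> fin_cases j <;> first
        | (exfalso; revert hij; decide)
        | exact hirr _ _ (by assumption)
        | exact (hirr _ _ (by assumption)).symm
        | exact hyx _ _ (by assumption) (by assumption)
    intro i j hij
    rcases lt_trichotomy i j with h' | h' | h'
    · exact absurd hij (h _ _ h')
    · exact h'
    · exact absurd hij.symm (h _ _ h')
  obtain ⟨e', he'⟩ := (Finite.surjective_of_injective hinj).hasRightInverse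
  have he'' : ∀ i, e' (e i) = i := fun i => hinj (he' _)
  let γ : ℕ → ℕ := fun u => if h : u < 29 then e' (β ⟨u, h⟩) else 0
  refine no_hom_tour (b := b) (γ := γ) hb ?_ ?_ ?_ ?_ ?_
  · intro u hu
    simp only [γ, hu, dif_pos]
    exact (e' _).isLt
  · intro u v hu hv h
    simp only [γ, hu, hv, dif_pos]
    refine he _ _ ?_
    rw [he', he']
    exact hA ⟨u, hu⟩ ⟨v, hv⟩ h
  · have := he'' 1
    simpa [γ, e, ← h26] using congrArg Fin.val this
  · have := he'' 0
    simpa [γ, e] using congrArg Fin.val this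
  · have := he'' 4
    simpa [γ, e, ← h28] using congrArg Fin.val this
end HalinColoring

namespace HalinColoring
open SimpleGraph

/-! ### The example as a Halin graph -/

/-- The underlying graph of the example. -/
def exGraph : SimpleGraph (Fin 29) := exDigraph.toSimpleGraphInclusive

instance exGraph_decidableAdj : DecidableRel exGraph.Adj := fun u v =>
  inferInstanceAs (Decidable (u ≠ v ∧ (exArc u v = true ∨ exArc v u = true)))

/-- The neighbour that follows `v` around the vertex `u` in a plane drawing of the example. -/
def exNextNat (u v : ℕ) : ℕ :=
  if u < 26 then
    if v = exParent u then (u + 25) % 26 else if v = (u + 25) % 26 then (u + 1) % 26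
    else exParent u
  else if u = 26 then (if v = 27 then 0 else if v = 8 then 27 else v + 1)
  else if u = 27 then
    (if v = 26 then 9 else if v = 16 then 28 else if v = 28 then 25 else v + 1)
  else (if v = 27 then 17 else if v = 24 then 27 else v + 1)

/-- `exNextNat` on the vertices of the example. -/
def exNext (u v : Fin 29) : Fin 29 := Fin.ofNat 29 (exNextNat u v)

theorem exNext_adj : ∀ u v, exGraph.Adj u v → exGraph.Adj u (exNext u v) := by decide +kernel

theorem exNext_inj : ∀ u v w, exGraph.Adj u v → exGraph.Adj u w → exNext u v = exNext u w →
    v = w := by decide +kernel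

theorem exNext_cyclic : ∀ u v w, exGraph.Adj u v → exGraph.Adj u w →
    ∃ k < 12, (exNext u)^[k] v = w := by decide +kernel

/-- The face of the dart `(u, v)`: the external face has number `26`, and the face
inside of the external edge `{i, i + 1}` has number `i`. -/
def exFaceNat (u v : ℕ) : ℕ :=
  if u < 26 then
    if v < 26 then (if v = (u + 1) % 26 then 26 else v) else u
  else if v < 26 then (v + 25) % 26
  else if u = 26 then 8 else if v = 28 then 16 else if u = 28 then 24 else 25

/-- `exFaceNat` on the darts of the example. -/
def exFace (u v : Fin 29) : Fin 27 := Fin.ofNat 27 (exFaceNat u v)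

theorem exFace_next : ∀ u v, exGraph.Adj u v → exFace v (exNext v u) = exFace u v := by
  decide +kernel

/-- One step of the boundary walk of a face. -/
def exTrace (d : Fin 29 × Fin 29) : Fin 29 × Fin 29 := (d.2, exNext d.2 d.1)

/-- A dart on each face. -/
def exBase (i : Fin 27) : Fin 29 × Fin 29 :=
  if i.val = 26 then (0, 1) else (Fin.ofNat 29 ((i + 1) % 26), Fin.ofNat 29 i)

theorem exBase_adj : ∀ i, exGraph.Adj (exBase i).1 (exBase i).2 ∧
    exFace (exBase i).1 (exBase i).2 = i := by decide +kernel

/-- Each of the numbers stands for one face only: all darts with this number lie on one boundary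
walk. -/
theorem exTrace_base : ∀ u v, exGraph.Adj u v →
    ∃ k < 27, exTrace^[k] (exBase (exFace u v)) = (u, v) := by decide +kernel

/-- The tree of the example. -/
def exTree : SimpleGraph (Fin 29) where
  Adj u v := exGraph.Adj u v ∧ (26 ≤ u.val ∨ 26 ≤ v.val)
  symm := ⟨fun _ _ h => ⟨h.1.symm, h.2.symm⟩⟩
  loopless := ⟨fun _ h => h.1.ne rfl⟩

instance exTree_decidableAdj : DecidableRel exTree.Adj := fun u v =>
  inferInstanceAs (Decidable (exGraph.Adj u v ∧ (26 ≤ u.val ∨ 26 ≤ v.val)))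

/-- All vertices have distance at most two from the vertex `27`. -/
theorem exTree_reach : ∀ v, v = 27 ∨ ∃ w, exTree.Adj v w ∧ (w = 27 ∨ exTree.Adj w 27) := by
  decide +kernel

theorem exGraph_degrees : ∑ v, exGraph.degree v = 108 := by decide +kernel

theorem exTree_degrees : ∑ v, exTree.degree v = 56 := by decide +kernel

theorem exTree_leaf : ∀ v, exTree.degree v = 1 ↔ v.val < 26 := by decide +kernel

theorem exDigraph_isOriented : exDigraph.IsOriented := by
  unfold Digraph.IsOriented
  decide +kernel

/-- The permutation of the darts that turns around their first vertex. -/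
noncomputable def exRotPerm : Equiv.Perm exGraph.Dart :=
  Equiv.ofBijective
    (fun d : exGraph.Dart => (⟨(d.fst, exNext d.fst d.snd), exNext_adj _ _ d.adj⟩ : exGraph.Dart))
    (Finite.injective_iff_bijective.1 (by
      intro d d' h
      obtain ⟨h1, h2⟩ : d.fst = d'.fst ∧ exNext d.fst d.snd = exNext d'.fst d'.snd :=
        Prod.ext_iff.1 ((Dart.ext_iff _ _).1 h)
      have had := d'.adj
      rw [← h1] at h2 had
      exact Dart.ext _ _ (Prod.ext h1 (exNext_inj _ _ _ d.adj had h2))))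

theorem exRotPerm_apply (d : exGraph.Dart) :
    (exRotPerm d).toProd = (d.fst, exNext d.fst d.snd) := rfl

theorem exRotPerm_pow (d : exGraph.Dart) (k : ℕ) :
    ((exRotPerm ^ k) d).toProd = (d.fst, (exNext d.fst)^[k] d.snd) := by
  induction k with
  | zero => rfl
  | succ k ih => rw [pow_succ', Equiv.Perm.mul_apply, exRotPerm_apply, ih,
      Function.iterate_succ_apply']

/-- The rotation system of the drawing. -/
noncomputable def exRotation : RotationSystem exGraph where
  rot := exRotPerm
  isCycleOn := by
    intro v
    refine ⟨⟨fun d hd => hd, exRotPerm.injective.injOn, fun d hd => ?_⟩, ?_⟩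
    · refine ⟨exRotPerm.symm d, ?_, exRotPerm.apply_symm_apply d⟩
      have := exRotPerm_apply (exRotPerm.symm d)
      rw [exRotPerm.apply_symm_apply] at this
      exact (congrArg Prod.fst this).symm.trans hd
    · intro d hd d' hd'
      have h : d'.fst = d.fst := Eq.trans hd' (Eq.symm hd)
      have hadj : exGraph.Adj d.fst d'.snd := h ▸ d'.adj
      obtain ⟨k, -, hk⟩ := exNext_cyclic d.fst d.snd d'.snd d.adj hadj
      refine ⟨k, Dart.ext _ _ ?_⟩
      rw [zpow_natCast, exRotPerm_pow, hk, ← h]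

theorem exRotation_facePerm (d : exGraph.Dart) :
    (exRotation.facePerm d).toProd = exTrace d.toProd := rfl

theorem exRotation_facePerm_pow (d : exGraph.Dart) (k : ℕ) :
    ((exRotation.facePerm ^ k) d).toProd = exTrace^[k] d.toProd := by
  induction k with
  | zero => rfl
  | succ k ih => rw [pow_succ', Equiv.Perm.mul_apply, exRotation_facePerm, ih,
      Function.iterate_succ_apply']

/-- The number of a face. -/
noncomputable def exFaceEquiv : exRotation.Face ≃ Fin 27 := by
  refine Equiv.ofBijective (Quotient.lift (fun d : exGraph.Dart => exFace d.fst d.snd) ?_) ⟨?_, ?_⟩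
  · have step : ∀ d : exGraph.Dart, exFace (exRotation.facePerm d).fst (exRotation.facePerm d).snd
        = exFace d.fst d.snd := fun d => exFace_next _ _ d.adj
    have hpow : ∀ (k : ℕ) (d : exGraph.Dart), exFace ((exRotation.facePerm ^ k) d).fst
        ((exRotation.facePerm ^ k) d).snd = exFace d.fst d.snd := by
      intro k
      induction k with
      | zero => intro d; rfl
      | succ k ih => intro d; rw [pow_succ', Equiv.Perm.mul_apply, step, ih]
    intro d d' h
    obtain ⟨k, -, hk⟩ := Equiv.Perm.SameCycle.exists_pow_eq'
      (h : exRotation.facePerm.SameCycle d d')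
    have := hpow k d
    rw [hk] at this
    exact this.symm
  · intro F F'
    refine Quotient.inductionOn₂ F F' fun d d' h => Quotient.sound ?_
    have key : ∀ d : exGraph.Dart, exRotation.facePerm.SameCycle
        ⟨exBase (exFace d.fst d.snd), (exBase_adj _).1⟩ d := by
      intro d
      obtain ⟨k, -, hk⟩ := exTrace_base _ _ d.adj
      refine ⟨k, Dart.ext _ _ ?_⟩
      rw [zpow_natCast, exRotation_facePerm_pow, hk]
    have h1 := key d
    simp only [show exFace d.fst d.snd = exFace d'.fst d'.snd from h] at h1
    exact h1.symm.trans (key d')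
  · intro i
    exact ⟨exRotation.face ⟨exBase i, (exBase_adj i).1⟩, (exBase_adj i).2⟩

theorem exFaceEquiv_face (d : exGraph.Dart) :
    exFaceEquiv (exRotation.face d) = exFace d.fst d.snd := rfl

theorem exTree_isTree : exTree.IsTree := by
  have hr : ∀ v, exTree.Reachable v 27 := by
    intro v
    rcases exTree_reach v with rfl | ⟨w, h, rfl | h'⟩
    · exact Reachable.refl _
    · exact h.reachable
    · exact h.reachable.trans h'.reachable
  have : exTree.Connected := ⟨fun u v => (hr u).trans (hr v).symm⟩
  rw [isTree_iff_connected_and_card]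
  refine ⟨this, ?_⟩
  have h := exTree.sum_degrees_eq_twice_card_edges
  rw [exTree_degrees] at h
  rw [Nat.card_eq_fintype_card, ← edgeFinset_card, Nat.card_eq_fintype_card, Fintype.card_fin]
  omega

theorem exGraph_isHalin : exGraph.IsHalin := by
  have hF : ∀ d : exGraph.Dart, exRotation.face d = exFaceEquiv.symm 26 ↔
      d.fst.val < 26 ∧ d.snd.val = (d.fst.val + 1) % 26 := by
    intro d
    rw [Equiv.eq_symm_apply, exFaceEquiv_face]
    have : ∀ u v, exGraph.Adj u v → (exFace u v = 26 ↔ u.val < 26 ∧ v.val = (u.val + 1) % 26) := by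
      decide +kernel
    exact this _ _ d.adj
  have hT : exGraph.deleteEdges (exRotation.faceEdges (exFaceEquiv.symm 26)) = exTree := by
    have h : ∀ u v, exGraph.Adj u v → ((u.val < 26 ∧ v.val = (u.val + 1) % 26) ∨
        (v.val < 26 ∧ u.val = (v.val + 1) % 26) ↔ ¬ (26 ≤ u.val ∨ 26 ≤ v.val)) := by
      decide +kernel
    ext u v
    rw [deleteEdges_adj]
    refine and_congr_right fun huv => ?_
    rw [← not_iff_comm.1 (h u v huv).symm, not_iff_not]
    constructor
    · rintro ⟨d, hd, he⟩
      have := (hF d).1 hd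
      rcases dart_edge_eq_mk'_iff'.1 he with ⟨h1, h2⟩ | ⟨h1, h2⟩
      · left; rwa [h1, h2] at this
      · right; rwa [h1, h2] at this
    · rintro (h1 | h1)
      · exact ⟨⟨(u, v), huv⟩, (hF _).2 h1, rfl⟩
      · exact ⟨⟨(v, u), huv.symm⟩, (hF _).2 h1, Sym2.eq_swap⟩
  have hL : exTree.leaves = {v | v.val < 26} := by
    ext v
    rw [leaves, Set.mem_ofPred_eq, Set.mem_ofPred_eq, ← exTree_leaf v,
      Set.ncard_eq_toFinset_card', ← neighborFinset, card_neighborFinset_eq_degree]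
  have hE : Nat.card exGraph.edgeSet = 54 := by
    have h := exGraph.sum_degrees_eq_twice_card_edges
    rw [exGraph_degrees] at h
    rw [Nat.card_eq_fintype_card, ← edgeFinset_card]
    omega
  refine ⟨inferInstance, exRotation, ⟨?_, ?_⟩, exFaceEquiv.symm 26, ?_, ?_, ?_⟩
  · exact exTree_isTree.connected.mono fun u v (h : exTree.Adj u v) => h.1
  · rw [hE, Nat.card_congr exFaceEquiv, Nat.card_eq_fintype_card, Nat.card_eq_fintype_card,
      Fintype.card_fin, Fintype.card_fin]
  · rw [hT]; exact exTree_isTree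
  · rw [hT, hL, Set.ncard_eq_toFinset_card']
    decide +kernel
  · rw [hT, hL]
    ext v
    have : ∀ v : Fin 29, v.val < 26 → ∃ w, exGraph.Adj v w ∧ w.val = (v.val + 1) % 26 := by
      decide +kernel
    constructor
    · intro hv
      obtain ⟨w, hw, h⟩ := this v hv
      exact ⟨⟨(v, w), hw⟩, (hF _).2 ⟨hv, h⟩, rfl⟩
    · rintro ⟨d, hd, rfl⟩
      exact ((hF d).1 hd).1

end HalinColoring

namespace HalinColoring

/-! ### Arithmetic of the tournament `T₇` -/

/-- Whether `x` is a nonzero square modulo `7`, that is, congruent to `1`, `2` or `4`. -/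
def isQuad (x : ℕ) : Bool := Nat.testBit 22 (x % 7)

/-- Whether `T₇` has the arc `(u, v)` (for `s = true`) or the arc `(v, u)` (for `s = false`), for
natural numbers that represent elements of `ℤ/7ℤ`. -/
def stepNat (s : Bool) (u v : ℕ) : Bool := bif s then isQuad (v + 6 * u) else isQuad (u + 6 * v)

/-- A representative of `1` or `-1` in `ℤ/7ℤ`. -/
def signNat (s : Bool) : ℕ := bif s then 1 else 6

/-- Congruence modulo `7`. -/
def eqNat (x y : ℕ) : Bool := Nat.beq (x % 7) (y % 7)

/-- The nonzero squares modulo `7`. -/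
def quads : List ℕ := [1, 2, 4]

/-- The nonzero residues modulo `7`. -/
def units : List ℕ := [1, 2, 3, 4, 5, 6]

/-- Both signs. -/
def signs : List Bool := [true, false]

theorem mem_signs (s : Bool) : s ∈ signs := by cases s <;> simp [signs]

/-- Let a vertex `x` have three neighbours with the colours `0`, `l`, `m`, where the arcs between
them are `0 → x` iff `e`, `m → x` iff `am`, and `x → l` iff `al`. This says that no in-neighbour of
`x` has the colour of an out-neighbour. -/
def noConflict (e am al : Bool) (l m : ℕ) : Bool :=
  (e == am || !eqNat m 0) && (e != al || !eqNat l 0) && (am != al || !eqNat l m)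

/-- Pieces of the types `(α, b)` and `(α', b')`, joined by an edge of the direction `s`: the type of
their union is `(α'', b'')`. -/
theorem type_append_check : (signs.all fun s => signs.all fun α => signs.all fun α' =>
    units.all fun b => units.all fun b' => signs.any fun α'' => units.any fun b'' =>
      quads.all fun q => quads.any fun q₁ => quads.any fun q₂ =>
        eqNat (signNat α * q₁) (signNat α'' * q) && eqNat (b' * q₂) (b'' * q) &&
          stepNat s (b * q₁) (signNat α' * q₂)) = true := by
  decide +kernel

/-- A piece of the type `(α, b)` that is attached to `x`, where the direction of the edge `p x` is
`s`: the type of the piece seen from `p` is `(α'', b'')`. Here `t` is the colour of `x`. -/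
theorem type_lift_check : (signs.all fun s => signs.all fun α => units.all fun b =>
    signs.any fun α'' => units.any fun b'' => quads.all fun q => quads.any fun q₁ =>
      units.any fun t => stepNat s 0 t &&
        eqNat (t + signNat α * q₁) (signNat α'' * q) && eqNat (t + b * q₁) (b'' * q)) = true := by
  decide +kernel

/-- The branches at a hub of colour `0` are, in cyclic order, the exceptional one, a thread of
sign `e₁`, a piece of type `(α', b')`, and a thread of sign `e₂`. The exceptional branch starts
with an edge of direction `s`, after which it has the type `(α, b)`. The directions of the edges
of the external cycle between these four parts are `a₀`, `a₁`, `a₂`, `a₃`. Then the graph without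
the end of the first thread can be coloured such that there is no conflict at this vertex, or this
holds for the second thread. -/
theorem hub_check_three : (signs.all fun α => units.all fun b => signs.all fun s =>
    signs.all fun e₁ => signs.all fun e₂ => signs.all fun α' => units.all fun b' =>
    signs.all fun a₀ => signs.all fun a₁ => signs.all fun a₂ => signs.all fun a₃ =>
      (quads.any fun q₂ => stepNat a₂ b' (signNat e₂ * q₂) &&
        units.any fun t => stepNat s 0 t && quads.any fun q₃ =>
          stepNat a₃ (signNat e₂ * q₂) (t + signNat α * q₃) &&
            noConflict e₁ a₀ a₁ (signNat α') (t + b * q₃)) ||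
      (quads.any fun q₁ => stepNat a₁ (signNat e₁ * q₁) (signNat α') &&
        units.any fun t => stepNat s 0 t && quads.any fun q₃ =>
          stepNat a₀ (t + b * q₃) (signNat e₁ * q₁) &&
            noConflict e₂ a₂ a₃ (t + signNat α * q₃) b')) = true := by
  decide +kernel

/-- As `hub_check_three`, but without a piece between the two threads, so that an edge of
direction `a₁` joins their ends. -/
theorem hub_check_two : (signs.all fun α => units.all fun b => signs.all fun s =>
    signs.all fun e₁ => signs.all fun e₂ =>
    signs.all fun a₀ => signs.all fun a₁ => signs.all fun a₃ =>
      (quads.any fun q₂ => units.any fun t => stepNat s 0 t && quads.any fun q₃ =>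
        stepNat a₃ (signNat e₂ * q₂) (t + signNat α * q₃) &&
          noConflict e₁ a₀ a₁ (signNat e₂ * q₂) (t + b * q₃)) ||
      (quads.any fun q₁ => units.any fun t => stepNat s 0 t && quads.any fun q₃ =>
        stepNat a₀ (t + b * q₃) (signNat e₁ * q₁) &&
          noConflict e₂ a₁ a₃ (t + signNat α * q₃) (signNat e₁ * q₁))) = true := by
  decide +kernel

/-- The external cycle of a wheel has the direction `s`. The spokes of two consecutive vertices have
the directions `s` and `!s`, and they are preceded by a piece of type `(α, b)`. Then there is no
conflict at the vertex that follows. -/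
theorem star_check : (signs.all fun s => signs.all fun e => signs.all fun α => units.all fun b =>
    quads.any fun q₁ => stepNat s b (signNat s * q₁) && quads.any fun q₂ =>
      stepNat s (signNat s * q₁) (signNat (!s) * q₂) &&
        noConflict e s s (signNat α) (signNat (!s) * q₂)) = true := by
  decide +kernel

/-- As `star_check`, for a wheel with three spokes. -/
theorem star_check_three : (signs.all fun s => signs.all fun e =>
    quads.any fun q₁ => quads.any fun q₂ =>
      stepNat s (signNat s * q₁) (signNat (!s) * q₂) &&
        noConflict e s s (signNat s * q₁) (signNat (!s) * q₂)) = true := by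
  decide +kernel

theorem isQuad_cast {x : ℕ} (h : isQuad x = true) :
    (x : ZMod 7) = 1 ∨ (x : ZMod 7) = 2 ∨ (x : ZMod 7) = 4 := by
  have hx : (x : ZMod 7) = ((x % 7 : ℕ) : ZMod 7) := by simp
  have : x % 7 < 7 := Nat.mod_lt _ (by norm_num)
  rw [hx]
  unfold isQuad at h
  interval_cases x % 7 <;> first | (exfalso; revert h; decide) | decide

theorem eqNat_iff (x y : ℕ) : eqNat x y = true ↔ (x : ZMod 7) = y := by
  rw [eqNat, Nat.beq_eq, ZMod.natCast_eq_natCast_iff']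

/-- The arc `(u, v)` for `s = true`, the arc `(v, u)` for `s = false`. -/
def Step (s : Bool) (u v : ZMod 7) : Prop :=
  if s = true then Digraph.T7.Adj u v else Digraph.T7.Adj v u

theorem step_of_stepNat {s : Bool} {u v : ℕ} (h : stepNat s u v = true) (c : ZMod 7) :
    Step s (c + u) (c + v) := by
  have h7 : (7 : ZMod 7) = 0 := rfl
  cases s
  · have := isQuad_cast h
    have h' : ((u + 6 * v : ℕ) : ZMod 7) = c + u - (c + v) := by
      push_cast
      linear_combination (v : ZMod 7) * h7
    rw [h'] at this
    exact this
  · have := isQuad_cast h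
    have h' : ((v + 6 * u : ℕ) : ZMod 7) = c + v - (c + u) := by
      push_cast
      linear_combination (u : ZMod 7) * h7
    rw [h'] at this
    exact this

/-! ### Colourings of pieces of the graph -/

variable {V : Type*} {D : Digraph V}

/-- The arcs between `x` and `y` are respected by the colours `u` of `x` and `v` of `y`. -/
def Compat (D : Digraph V) (x y : V) (u v : ZMod 7) : Prop :=
  (D.Adj x y → Digraph.T7.Adj u v) ∧ (D.Adj y x → Digraph.T7.Adj v u)

theorem Compat.symm {x y : V} {u v : ZMod 7} (h : Compat D x y u v) : Compat D y x v u :=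
  ⟨h.2, h.1⟩

open Classical in
/-- Whether the arc between `x` and `y` goes from `x` to `y`. -/
noncomputable def dir (D : Digraph V) (x y : V) : Bool := decide (D.Adj x y)

theorem compat_of_step (hD : D.IsOriented) {x y : V} {u v : ZMod 7}
    (h : Step (dir D x y) u v) : Compat D x y u v := by
  by_cases hxy : D.Adj x y
  · have : dir D x y = true := by simp [dir, hxy]
    rw [this] at h
    exact ⟨fun _ => h, fun h' => absurd h' (hD _ _ hxy)⟩
  · have : dir D x y = false := by simp [dir, hxy]
    rw [this] at h
    exact ⟨fun h' => absurd h' hxy, fun _ => h⟩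

/-- `f` is a homomorphism to `T₇` on the subgraph induced by `S`. -/
def HomOn (D : Digraph V) (f : V → ZMod 7) (S : Set V) : Prop :=
  ∀ x ∈ S, ∀ y ∈ S, D.Adj x y → Digraph.T7.Adj (f x) (f y)

/-- Some homomorphism to `T₇` on the subgraph induced by `S` and the vertex `p` gives `p`, `l`, `m`
the colours `c`, `u`, `v`. -/
def Realizes (D : Digraph V) (p : V) (S : Set V) (l m : V) (c u v : ZMod 7) : Prop :=
  ∃ f : V → ZMod 7, f p = c ∧ f l = u ∧ f m = v ∧ HomOn D f (insert p S)

/-- The only edge between `S` and `S'` is the one that joins `m` and `l'`. -/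
def OnlyEdge (D : Digraph V) (S S' : Set V) (m l' : V) : Prop :=
  ∀ x ∈ S, ∀ y ∈ S', D.Adj x y ∨ D.Adj y x → x = m ∧ y = l'

/-- Two consecutive pieces at the same vertex are coloured independently of each other, except for
the edge between them. -/
theorem Realizes.append {p : V} {S S' : Set V} {l m l' m' : V} {c u v u' v' : ZMod 7}
    (h : Realizes D p S l m c u v) (h' : Realizes D p S' l' m' c u' v')
    (hd : Disjoint S S') (hp : p ∉ S') (hl : l ∈ S) (hm : m ∈ S) (hl' : l' ∈ S') (hm' : m' ∈ S')
    (he : OnlyEdge D S S' m l') (hc : Compat D m l' v u') :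
    Realizes D p (S ∪ S') l m' c u v' := by
  classical
  obtain ⟨f, hfp, hfl, hfm, hf⟩ := h
  obtain ⟨f', hfp', hfl', hfm', hf'⟩ := h'
  have hS : ∀ x ∈ S, x ∉ S' := fun x hx hx' => Set.disjoint_left.1 hd hx hx'
  refine ⟨fun x => if x ∈ S' then f' x else f x, ?_, ?_, ?_, ?_⟩
  · simp [hp, hfp]
  · simp [hS l hl, hfl]
  · simp [hm', hfm']
  · have key : ∀ x ∈ insert p (S ∪ S'), (x ∈ insert p S ∧ x ∉ S') ∨ x ∈ S' := by
      rintro x (rfl | hx | hx)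
      · exact Or.inl ⟨Or.inl rfl, hp⟩
      · exact Or.inl ⟨Or.inr hx, hS x hx⟩
      · exact Or.inr hx
    have hmix : ∀ x ∈ insert p S, x ∉ S' → ∀ y ∈ S', Compat D x y (f x) (f' y) := by
      rintro x (rfl | hx) hx' y hy
      · rw [hfp, ← hfp']
        exact ⟨fun h => hf' _ (Or.inl rfl) _ (Or.inr hy) h,
          fun h => hf' _ (Or.inr hy) _ (Or.inl rfl) h⟩
      · constructor
        · intro h
          obtain ⟨rfl, rfl⟩ := he x hx y hy (Or.inl h)
          rw [hfm, hfl']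
          exact hc.1 h
        · intro h
          obtain ⟨rfl, rfl⟩ := he x hx y hy (Or.inr h)
          rw [hfm, hfl']
          exact hc.2 h
    intro x hx y hy hxy
    rcases key x hx with ⟨h1, h2⟩ | h1 <;> rcases key y hy with ⟨h3, h4⟩ | h3
    · simpa [h2, h4] using hf x h1 y h3 hxy
    · simpa [h2, h3] using (hmix x h1 h2 y h3).1 hxy
    · simpa [h1, h4] using (hmix y h3 h4 x h1).2 hxy
    · simpa [h1, h3] using hf' x (Or.inr h1) y (Or.inr h3) hxy

/-- If a piece is attached to `x`, then together with `x` it can be attached to `p`. -/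
theorem Realizes.lift (hD : D.IsOriented) {p x : V} {S : Set V} {l m : V} {c t u v : ZMod 7}
    (h : Realizes D x S l m t u v) (hp : p ∉ S) (hpx : p ≠ x) (hl : l ∈ S) (hm : m ∈ S)
    (he : ∀ y ∈ S, ¬ D.Adj p y ∧ ¬ D.Adj y p) (hc : Compat D p x c t) :
    Realizes D p (insert x S) l m c u v := by
  classical
  obtain ⟨f, hfp, hfl, hfm, hf⟩ := h
  have hne : ∀ y ∈ insert x S, y ≠ p := by
    rintro y (rfl | hy) rfl
    · exact hpx rfl
    · exact hp hy
  have hcp : ∀ y ∈ insert x S, Compat D p y c (f y) := by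
    rintro y (rfl | hy)
    · rwa [hfp]
    · exact ⟨fun h => absurd h (he y hy).1, fun h => absurd h (he y hy).2⟩
  refine ⟨Function.update f p c, by simp, ?_, ?_, ?_⟩
  · rw [Function.update_of_ne (hne l (Or.inr hl)), hfl]
  · rw [Function.update_of_ne (hne m (Or.inr hm)), hfm]
  · rintro y (rfl | hy) z (rfl | hz) hyz
    · exact absurd hyz (hD _ _ hyz)
    · rw [Function.update_self, Function.update_of_ne (hne z hz)]
      exact (hcp z hz).1 hyz
    · rw [Function.update_self, Function.update_of_ne (hne y hy)]
      exact (hcp y hy).2 hyz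
    · rw [Function.update_of_ne (hne y hy), Function.update_of_ne (hne z hz)]
      exact hf y hy z hz hyz

theorem Realizes.leaf (hD : D.IsOriented) {p y : V} {c u : ZMod 7} (hpy : p ≠ y)
    (hc : Compat D p y c u) : Realizes D p {y} y y c u u := by
  classical
  refine ⟨fun x => if x = p then c else u, by simp, by simp [hpy.symm], by simp [hpy.symm], ?_⟩
  rintro x (rfl | rfl) z (rfl | rfl) h
  · exact absurd h (hD _ _ h)
  · simpa [hpy.symm] using hc.1 h
  · simpa [hpy.symm] using hc.2 h
  · exact absurd h (hD _ _ h)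

/-- The colourings of a piece of the graph that is attached to the vertex `p` and meets the external
cycle in a path from `l` to `m`: relative to the colour of `p`, the colours of `l` and `m` can
be `(± q, b * q)` for all nonzero squares `q`. -/
def HasType (D : Digraph V) (p : V) (S : Set V) (l m : V) (α : Bool) (b : ℕ) : Prop :=
  ∀ c : ZMod 7, ∀ q ∈ quads, Realizes D p S l m c (c + (signNat α * q : ℕ)) (c + (b * q : ℕ))

/-- The piece has some type with a nonzero second coordinate. -/
def Typed (D : Digraph V) (p : V) (S : Set V) (l m : V) : Prop :=
  ∃ α, ∃ b ∈ units, HasType D p S l m α b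

theorem Typed.append (hD : D.IsOriented) {p : V} {S S' : Set V} {l m l' m' : V}
    (h : Typed D p S l m) (h' : Typed D p S' l' m')
    (hd : Disjoint S S') (hp : p ∉ S') (hl : l ∈ S) (hm : m ∈ S) (hl' : l' ∈ S') (hm' : m' ∈ S')
    (he : OnlyEdge D S S' m l') : Typed D p (S ∪ S') l m' := by
  obtain ⟨α, b, hb, h⟩ := h
  obtain ⟨α', b', hb', h'⟩ := h'
  have hc := type_append_check
  simp only [List.all_eq_true, List.any_eq_true, Bool.and_eq_true, eqNat_iff] at hc
  obtain ⟨α'', -, b'', hb'', hc⟩ :=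
    hc (dir D m l') (mem_signs _) α (mem_signs _) α' (mem_signs _) b hb b' hb'
  refine ⟨α'', b'', hb'', fun c q hq => ?_⟩
  obtain ⟨q₁, hq₁, q₂, hq₂, ⟨h1, h2⟩, h3⟩ := hc q hq
  rw [← h1, ← h2]
  exact (h c q₁ hq₁).append (h' c q₂ hq₂) hd hp hl hm hl' hm' he
    (compat_of_step hD (step_of_stepNat h3 c))

/-- The colourings of a piece attached to a neighbour of `p`, as seen from `p`. -/
theorem HasType.realizes_lift (hD : D.IsOriented) {p x : V} {S : Set V} {l m : V} {α : Bool}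
    {b : ℕ} (h : HasType D x S l m α b) (hp : p ∉ S) (hpx : p ≠ x) (hl : l ∈ S) (hm : m ∈ S)
    (he : ∀ y ∈ S, ¬ D.Adj p y ∧ ¬ D.Adj y p) (c : ZMod 7) {t q : ℕ} (hq : q ∈ quads)
    (ht : stepNat (dir D p x) 0 t = true) :
    Realizes D p (insert x S) l m c (c + (t + signNat α * q : ℕ)) (c + (t + b * q : ℕ)) := by
  have h1 := h (c + t) q hq
  have h2 := step_of_stepNat ht c
  rw [Nat.cast_zero, add_zero] at h2
  rw [add_assoc, add_assoc, ← Nat.cast_add, ← Nat.cast_add] at h1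
  exact h1.lift hD hp hpx hl hm he (compat_of_step hD h2)

theorem Typed.lift (hD : D.IsOriented) {p x : V} {S : Set V} {l m : V}
    (h : Typed D x S l m) (hp : p ∉ S) (hpx : p ≠ x) (hl : l ∈ S) (hm : m ∈ S)
    (he : ∀ y ∈ S, ¬ D.Adj p y ∧ ¬ D.Adj y p) : Typed D p (insert x S) l m := by
  obtain ⟨α, b, hb, h⟩ := h
  have hc := type_lift_check
  simp only [List.all_eq_true, List.any_eq_true, Bool.and_eq_true, eqNat_iff] at hc
  obtain ⟨α'', -, b'', hb'', hc⟩ := hc (dir D p x) (mem_signs _) α (mem_signs _) b hb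
  refine ⟨α'', b'', hb'', fun c q hq => ?_⟩
  obtain ⟨q₁, hq₁, t, -, ⟨h1, h2⟩, h3⟩ := hc q hq
  rw [← h2, ← h3]
  exact h.realizes_lift hD hp hpx hl hm he c hq₁ h1

theorem signNat_mem_units (s : Bool) : signNat s ∈ units := by cases s <;> simp [signNat, units]

/-- A leaf has the type `(1, 1)` or `(-1, -1)`. -/
theorem hasType_leaf (hD : D.IsOriented) {p y : V} (hpy : p ≠ y) :
    HasType D p {y} y y (dir D p y) (signNat (dir D p y)) := by
  intro c q hq
  refine Realizes.leaf hD hpy (compat_of_step hD ?_)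
  have h : stepNat (dir D p y) 0 (signNat (dir D p y) * q) = true := by
    have : ∀ s, ∀ q ∈ quads, stepNat s 0 (signNat s * q) = true := by decide
    exact this _ _ hq
  simpa using step_of_stepNat h c

end HalinColoring

namespace HalinColoring

/-! ### Branches of a tree -/

/-- The branch of the tree `T` that hangs at the edge `c x` on the side of `x`: the vertices that
are closer to `x` than to `c`. -/
def branch {V : Type*} (T : SimpleGraph V) (c x : V) : Set V :=
  {v | T.dist v c = T.dist v x + 1}

section Branch

variable {V : Type*} {T : SimpleGraph V}

/-- In a tree, only one neighbour of `x` is closer to `v` than `x` is. -/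
theorem eq_of_dist_add_one (hT : T.IsTree) {v x y z : V} (hy : T.Adj y x) (hz : T.Adj z x)
    (hvy : T.dist v y + 1 = T.dist v x) (hvz : T.dist v z + 1 = T.dist v x) : y = z := by
  obtain ⟨p, -, hp⟩ := hT.connected.exists_path_of_dist v y
  obtain ⟨q, -, hq⟩ := hT.connected.exists_path_of_dist v z
  have h1 : (p.concat hy).IsPath :=
    SimpleGraph.Walk.isPath_of_length_eq_dist _ (by rw [SimpleGraph.Walk.length_concat, hp, hvy])
  have h2 : (q.concat hz).IsPath :=
    SimpleGraph.Walk.isPath_of_length_eq_dist _ (by rw [SimpleGraph.Walk.length_concat, hq, hvz])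
  have h3 := congrArg Subtype.val ((hT.isAcyclic.subsingleton_path _ _).elim ⟨_, h1⟩ ⟨_, h2⟩)
  have h4 := congrArg SimpleGraph.Walk.penultimate h3
  simpa using h4

theorem mem_branch_self {c x : V} (h : T.Adj c x) : x ∈ branch T c x := by
  have : T.dist x c = 1 := SimpleGraph.dist_eq_one_iff_adj.2 h.symm
  simp [branch, this]

theorem not_mem_branch {c x : V} : c ∉ branch T c x := by
  simp [branch]

theorem mem_branch_or (hT : T.IsTree) {c x : V} (h : T.Adj c x) (v : V) :
    v ∈ branch T c x ∨ v ∈ branch T x c :=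
  hT.dist_eq_dist_add_one_of_adj v h

/-- A branch consists of the vertex `x` and of the branches beyond it. -/
theorem exists_mem_branch (hT : T.IsTree) {c x v : V} (hv : v ∈ branch T c x) (hvx : v ≠ x) :
    ∃ y, T.Adj x y ∧ y ≠ c ∧ v ∈ branch T x y := by
  obtain ⟨p, hp⟩ := hT.connected.exists_walk_length_eq_dist x v
  cases p with
  | nil => exact absurd rfl hvx
  | @cons _ y _ h p =>
    have h1 : T.dist y v ≤ p.length := SimpleGraph.dist_le p
    rw [SimpleGraph.Walk.length_cons] at hp
    have h2 : T.dist v x = T.dist v y + 1 := by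
      have := hT.dist_eq_dist_add_one_of_adj v h
      rw [SimpleGraph.dist_comm (v := v)] at hp h1
      omega
    refine ⟨y, h, ?_, h2⟩
    rintro rfl
    simp only [branch, Set.mem_ofPred_eq] at hv
    omega

theorem branch_disjoint (hT : T.IsTree) {x y z : V} (hy : T.Adj x y) (hz : T.Adj x z)
    (hyz : y ≠ z) : Disjoint (branch T x y) (branch T x z) := by
  rw [Set.disjoint_left]
  intro v hv hv'
  exact hyz (eq_of_dist_add_one hT hy.symm hz.symm (Eq.symm hv) (Eq.symm hv'))

theorem branch_subset (hT : T.IsTree) {c x y : V} (hc : T.Adj c x) (hy : T.Adj x y)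
    (hyc : y ≠ c) : branch T x y ⊆ branch T c x := by
  intro v hv
  rcases mem_branch_or hT hc v with h | h
  · exact h
  · exact absurd h (Set.disjoint_left.1 (branch_disjoint hT hy hc.symm hyc) hv)

theorem branch_ssubset (hT : T.IsTree) {c x y : V} (hc : T.Adj c x) (hy : T.Adj x y)
    (hyc : y ≠ c) : branch T x y ⊂ branch T c x := by
  refine ⟨branch_subset hT hc hy hyc, fun h => ?_⟩
  exact not_mem_branch (h (mem_branch_self hc))

/-- A branch is joined to the rest of the tree by one edge only. -/
theorem branch_closed (hT : T.IsTree) {c x u v : V} (hc : T.Adj c x) (hu : u ∈ branch T c x)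
    (huv : T.Adj u v) : v ∈ branch T c x ∨ (u = x ∧ v = c) := by
  rcases mem_branch_or hT hc v with h | h
  · exact Or.inl h
  refine Or.inr ?_
  simp only [branch, Set.mem_ofPred_eq] at hu h
  have h1 := hT.dist_eq_dist_add_one_of_adj x huv
  have h2 := hT.dist_eq_dist_add_one_of_adj c huv
  rw [SimpleGraph.dist_comm, SimpleGraph.dist_comm (v := v)] at h1 h2
  by_cases hvc : v = c
  · subst hvc
    rw [SimpleGraph.dist_self] at h
    have : T.dist u x = 0 := by
      rw [SimpleGraph.dist_self] at h2
      omega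
    exact ⟨(hT.connected.dist_eq_zero_iff).1 this, rfl⟩
  · -- `v` has two neighbours that are closer to `x`, namely `u` and the next vertex towards `c`
    exfalso
    have hv : v ∈ branch T x c := h
    obtain ⟨y, hy, hyx, hvy⟩ := exists_mem_branch hT hv hvc
    obtain ⟨p, hp⟩ := hT.connected.exists_walk_length_eq_dist v c
    cases p with
    | nil => exact hvc rfl
    | @cons _ w _ hw p =>
      have h3 : T.dist w c ≤ p.length := SimpleGraph.dist_le p
      rw [SimpleGraph.Walk.length_cons] at hp
      have h4 := hT.connected.dist_triangle (u := w) (v := c) (w := x)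
      rw [SimpleGraph.dist_eq_one_iff_adj.2 hc] at h4
      have h5 := hT.dist_eq_dist_add_one_of_adj x hw
      rw [SimpleGraph.dist_comm, SimpleGraph.dist_comm (v := w)] at h5
      have h6 : u = w := eq_of_dist_add_one hT (v := x) huv hw.symm
        (by rw [SimpleGraph.dist_comm, SimpleGraph.dist_comm (v := v)]; omega)
        (by rw [SimpleGraph.dist_comm, SimpleGraph.dist_comm (v := v)]; omega)
      subst h6
      omega

end Branch

/-! ### Plane trees with a cycle through the leaves -/

/-- A leaf of `T`, that is, a vertex with exactly one neighbour. -/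
def IsLeaf {V : Type*} (T : SimpleGraph V) (v : V) : Prop := ∃ p, ∀ w, T.Adj v w ↔ w = p

theorem branch_leaf {V : Type*} {T : SimpleGraph V} (hT : T.IsTree) {c x : V}
    (h : T.Adj c x) (hx : IsLeaf T x) :
    branch T c x = {x} := by
  ext v
  constructor
  · intro hv
    by_contra hvx
    obtain ⟨y, hy, hyc, -⟩ := exists_mem_branch hT hv hvx
    obtain ⟨p, hp⟩ := hx
    exact hyc (((hp y).1 hy).trans ((hp c).1 h.symm).symm)
  · rintro rfl
    exact mem_branch_self h

/-- A combinatorial description of a Halin graph `G`: a spanning tree `T`, a cyclic order of the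
neighbours of each inner vertex, and the cyclic order of the leaves. -/
structure Frame {V : Type*} (G : SimpleGraph V) where
  /-- The tree. -/
  T : SimpleGraph V
  isTree : T.IsTree
  le : T ≤ G
  /-- The neighbour that follows `y` around the inner vertex `x`. -/
  next : V → V → V
  next_adj : ∀ x y, ¬ IsLeaf T x → T.Adj x y → T.Adj x (next x y)
  next_cyclic : ∀ x y z, ¬ IsLeaf T x → T.Adj x y → T.Adj x z → ∃ k, (next x)^[k] y = z
  /-- The leaf that follows a leaf on the external cycle. -/
  succ : V → V
  succ_leaf : ∀ u, IsLeaf T u → IsLeaf T (succ u)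
  succ_adj : ∀ u, IsLeaf T u → G.Adj u (succ u)
  succ_cyclic : ∀ u v, IsLeaf T u → IsLeaf T v → ∃ k, succ^[k] u = v
  adj : ∀ u v, G.Adj u v → ¬ T.Adj u v → IsLeaf T u ∧ IsLeaf T v ∧ (v = succ u ∨ u = succ v)
  /-- The first leaf of the branch at the edge `c x`. -/
  first : V → V → V
  first_leaf : ∀ c x, T.Adj c x → IsLeaf T x → first c x = x
  first_inner : ∀ c x, T.Adj c x → ¬ IsLeaf T x → first c x = first x (next x c)
  /-- From the other side, the first leaf of a branch is the leaf after the last leaf of the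
  branch. -/
  first_of_leaf : ∀ c x, T.Adj c x → IsLeaf T c → first c x = succ c
  three_leaves : 3 ≤ {v | IsLeaf T v}.ncard

namespace Frame

variable {V : Type*} {G : SimpleGraph V} (R : Frame G)

/-- `S` is attached to the tree by edges to the vertex `p` only, and its leaves form a path from `l`
to `m` on the external cycle. -/
structure Piece (p : V) (S : Set V) (l m : V) : Prop where
  notMem : p ∉ S
  closed : ∀ u ∈ S, ∀ v, R.T.Adj u v → v ∈ S ∨ v = p
  first_mem : l ∈ S
  last_mem : m ∈ S
  last_leaf : IsLeaf R.T m
  first_leaf : IsLeaf R.T l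
  succ_mem : ∀ u ∈ S, IsLeaf R.T u → u ≠ m → R.succ u ∈ S

variable {R}

/-- Between two consecutive pieces there is only the edge of the external cycle from the last leaf
of the first piece, provided that the two pieces do not contain all leaves. -/
theorem Piece.onlyEdge {D : Digraph V} (hD : D.IsOrientationOf G) {p : V} {S S' : Set V}
    {l m l' m' : V} (h : R.Piece p S l m) (h' : R.Piece p S' l' m') (hd : Disjoint S S')
    (hs : R.succ m = l') (ho : ∃ u, IsLeaf R.T u ∧ u ∉ S ∧ u ∉ S') : OnlyEdge D S S' m l' := by
  intro x hx y hy hxy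
  have hG : G.Adj x y := by
    rw [← hD.2]
    refine ⟨?_, hxy⟩
    rintro rfl
    exact Set.disjoint_left.1 hd hx hy
  have hT : ¬ R.T.Adj x y := by
    intro hT
    rcases h.closed x hx y hT with h1 | rfl
    · exact Set.disjoint_left.1 hd h1 hy
    · exact h'.notMem hy
  obtain ⟨hlx, hly, rfl | rfl⟩ := R.adj x y hG hT
  · have : x = m := by
      by_contra hne
      exact Set.disjoint_left.1 hd (h.succ_mem x hx hlx hne) hy
    exact ⟨this, by rw [this, hs]⟩
  · -- otherwise `S ∪ S'` would contain all leaves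
    exfalso
    have hym : y = m' := by
      by_contra hne
      exact Set.disjoint_left.1 hd hx (h'.succ_mem y hy hly hne)
    have hstep : ∀ u, IsLeaf R.T u → u ∈ S ∪ S' → R.succ u ∈ S ∪ S' := by
      rintro u hu (hu' | hu')
      · by_cases hum : u = m
        · rw [hum, hs]; exact Or.inr h'.first_mem
        · exact Or.inl (h.succ_mem u hu' hu hum)
      · by_cases hum : u = m'
        · rw [hum, ← hym]; exact Or.inl hx
        · exact Or.inr (h'.succ_mem u hu' hu hum)
    have hiter : ∀ k, IsLeaf R.T (R.succ^[k] y) ∧ R.succ^[k] y ∈ S ∪ S' := by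
      intro k
      induction k with
      | zero => exact ⟨hly, Or.inr hy⟩
      | succ k ih =>
        rw [Function.iterate_succ_apply']
        exact ⟨R.succ_leaf _ ih.1, hstep _ ih.1 ih.2⟩
    obtain ⟨u, hu, hu1, hu2⟩ := ho
    obtain ⟨k, hk⟩ := R.succ_cyclic y u hly hu
    rcases hk ▸ (hiter k).2 with h1 | h1
    · exact hu1 h1
    · exact hu2 h1

theorem Piece.append {p : V} {S S' : Set V} {l m l' m' : V} (h : R.Piece p S l m)
    (h' : R.Piece p S' l' m') (hs : R.succ m = l') : R.Piece p (S ∪ S') l m' where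
  notMem := fun hp => hp.elim h.notMem h'.notMem
  closed := by
    rintro u (hu | hu) v huv
    · exact (h.closed u hu v huv).imp_left Or.inl
    · exact (h'.closed u hu v huv).imp_left Or.inr
  first_mem := Or.inl h.first_mem
  last_mem := Or.inr h'.last_mem
  last_leaf := h'.last_leaf
  first_leaf := h.first_leaf
  succ_mem := by
    rintro u (hu | hu) hl hne
    · by_cases hum : u = m
      · rw [hum, hs]; exact Or.inr h'.first_mem
      · exact Or.inl (h.succ_mem u hu hl hum)
    · exact Or.inr (h'.succ_mem u hu hl hne)

/-- All branches at `x` but one make up, together with `x`, a branch. -/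
theorem Piece.lift {p x : V} {S : Set V} {l m : V} (h : R.Piece x S l m) (hx : ¬ IsLeaf R.T x)
    (hp : p ∉ insert x S) (hN : ∀ v, R.T.Adj x v → v ∈ S ∨ v = p) :
    R.Piece p (insert x S) l m where
  notMem := hp
  closed := by
    rintro u (rfl | hu) v huv
    · exact (hN v huv).imp_left Or.inr
    · rcases h.closed u hu v huv with h1 | rfl
      · exact Or.inl (Or.inr h1)
      · exact Or.inl (Or.inl rfl)
  first_mem := Or.inr h.first_mem
  last_mem := Or.inr h.last_mem
  last_leaf := h.last_leaf
  first_leaf := h.first_leaf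
  succ_mem := by
    rintro u (rfl | hu) hl hne
    · exact absurd hl hx
    · exact Or.inr (h.succ_mem u hu hl hne)

/-- Every branch contains a leaf. -/
theorem exists_leaf_mem_branch [Finite V] {c x : V} (h : R.T.Adj c x) :
    ∃ v ∈ branch R.T c x, IsLeaf R.T v := by
  induction hn : (branch R.T c x).ncard using Nat.strong_induction_on generalizing c x with
  | _ n ih =>
    by_cases hx : IsLeaf R.T x
    · exact ⟨x, mem_branch_self h, hx⟩
    · obtain ⟨y, hy, hyc⟩ : ∃ y, R.T.Adj x y ∧ y ≠ c := by
        by_contra! hno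
        exact hx ⟨c, fun w => ⟨hno w, fun hw => hw ▸ h.symm⟩⟩
      have hlt := Set.ncard_lt_ncard (branch_ssubset R.isTree h hy hyc) (Set.toFinite _)
      obtain ⟨v, hv, hl⟩ := ih _ (hn ▸ hlt) hy rfl
      exact ⟨v, branch_subset R.isTree h hy hyc hv, hl⟩

end Frame
end HalinColoring

namespace HalinColoring
namespace Frame

variable {V : Type*} {G : SimpleGraph V} {R : Frame G}

/-! ### Colourings of the branches -/

/-- `z 0 = y, z 1, …, z (k - 1)` are the neighbours of `p`, in their cyclic order. -/
structure CyclicOrder (R : Frame G) (p y : V) (k : ℕ) (z : ℕ → V) : Prop where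
  pos : 0 < k
  zero : z 0 = y
  last : z k = y
  step : ∀ i, z (i + 1) = R.next p (z i)
  adj : ∀ i, R.T.Adj p (z i)
  inj : ∀ i j, i < k → j < k → z i = z j → i = j
  surj : ∀ w, R.T.Adj p w → ∃ i < k, z i = w

/-- The enumeration follows the orbit of `y`, and `k` is its period. -/
theorem exists_cyclicOrder {p y : V} (hp : ¬ IsLeaf R.T p) (h : R.T.Adj p y) :
    ∃ k z, R.CyclicOrder p y k z := by
  have hadj : ∀ i, R.T.Adj p ((R.next p)^[i] y) := by
    intro i
    induction i with
    | zero => exact h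
    | succ i ih =>
      rw [Function.iterate_succ_apply']
      exact R.next_adj _ _ hp ih
  have hper : 0 < Function.minimalPeriod (R.next p) y := by
    obtain ⟨k, hk⟩ := R.next_cyclic p (R.next p y) y hp (R.next_adj _ _ hp h) h
    exact Function.IsPeriodicPt.minimalPeriod_pos (n := k + 1) (Nat.succ_pos k) hk
  refine ⟨Function.minimalPeriod (R.next p) y, fun i => (R.next p)^[i] y, hper, rfl,
    Function.iterate_minimalPeriod, fun i => Function.iterate_succ_apply' _ _ _, hadj, ?_, ?_⟩
  · intro i j hi hj hij
    exact Function.iterate_injOn_Iio_minimalPeriod hi hj hij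
  · intro w hw
    obtain ⟨i, hi⟩ := R.next_cyclic p y w hp h hw
    exact ⟨i % Function.minimalPeriod (R.next p) y, Nat.mod_lt _ hper,
      (Function.iterate_mod_minimalPeriod_eq).trans hi⟩

theorem CyclicOrder.ne_of_lt {p y : V} {k : ℕ} {z : ℕ → V} (h : R.CyclicOrder p y k z) {i j : ℕ}
    (hij : i < j) (hi : 0 < i) (hj : j ≤ k) : z i ≠ z j := by
  intro he
  rcases hj.lt_or_eq with hj | rfl
  · exact hij.ne (h.inj i j (hij.trans hj) hj he)
  · rw [h.last, ← h.zero] at he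
    exact hi.ne' (h.inj i 0 hij h.pos he)

/-- The union of the branches at `z a, …, z b` around the vertex `x`. -/
def span (T : SimpleGraph V) (x : V) (z : ℕ → V) (a b : ℕ) : Set V :=
  {v | ∃ i, a ≤ i ∧ i ≤ b ∧ v ∈ branch T x (z i)}

theorem span_self (T : SimpleGraph V) (x : V) (z : ℕ → V) (a : ℕ) :
    span T x z a a = branch T x (z a) := by
  ext v
  constructor
  · rintro ⟨i, h1, h2, h3⟩
    rwa [le_antisymm h2 h1] at h3
  · exact fun h => ⟨a, le_rfl, le_rfl, h⟩

theorem span_succ (T : SimpleGraph V) (x : V) (z : ℕ → V) {a b : ℕ} (hab : a ≤ b) :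
    span T x z a (b + 1) = span T x z a b ∪ branch T x (z (b + 1)) := by
  ext v
  constructor
  · rintro ⟨i, h1, h2, h3⟩
    rcases h2.lt_or_eq with h2 | rfl
    · exact Or.inl ⟨i, h1, Nat.le_of_lt_succ h2, h3⟩
    · exact Or.inr h3
  · rintro (⟨i, h1, h2, h3⟩ | h)
    · exact ⟨i, h1, h2.trans (Nat.le_succ b), h3⟩
    · exact ⟨b + 1, hab.trans (Nat.le_succ b), le_rfl, h⟩

theorem span_disjoint {x : V} {z : ℕ → V} {a b : ℕ} (hz : ∀ i, R.T.Adj x (z i)) {w : V}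
    (hw : R.T.Adj x w) (h : ∀ i, a ≤ i → i ≤ b → z i ≠ w) :
    Disjoint (span R.T x z a b) (branch R.T x w) := by
  rw [Set.disjoint_left]
  rintro v ⟨i, h1, h2, h3⟩ hv
  exact Set.disjoint_left.1 (branch_disjoint R.isTree (hz i) hw (h i h1 h2)) h3 hv

/-- The piece `S` attached to `p`, with all that is needed for its use as a part of a larger
piece: the leaf after its last leaf is `l'`, and the piece has a type. -/
structure TypedPiece (R : Frame G) (D : Digraph V) (p : V) (S : Set V) (l m l' : V) : Prop extends
    R.Piece p S l m where
  succ_last : R.succ m = l'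
  typed : Typed D p S l m

theorem TypedPiece.append {D : Digraph V} (hD : D.IsOrientationOf G) {p : V} {S S' : Set V}
    {l m l' m' l'' : V} (h : R.TypedPiece D p S l m l') (h' : R.TypedPiece D p S' l' m' l'')
    (hd : Disjoint S S') (ho : ∃ u, IsLeaf R.T u ∧ u ∉ S ∧ u ∉ S') :
    R.TypedPiece D p (S ∪ S') l m' l'' :=
  { h.toPiece.append h'.toPiece h.succ_last with
    succ_last := h'.succ_last
    typed := h.typed.append hD.1 h'.typed hd h'.notMem h.first_mem h.last_mem h'.first_mem
      h'.last_mem (h.toPiece.onlyEdge hD h'.toPiece hd h.succ_last ho) }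

/-- Consecutive branches around a vertex form a piece. -/
theorem typedPiece_span [Finite V] {D : Digraph V} (hD : D.IsOrientationOf G) {x : V}
    (hx : ¬ IsLeaf R.T x) {z : ℕ → V} (hz : ∀ i, R.T.Adj x (z i))
    (hstep : ∀ i, z (i + 1) = R.next x (z i)) {a b : ℕ} (hab : a ≤ b) {w : V} (hw : R.T.Adj x w)
    (hne : ∀ i, a ≤ i → i ≤ b → z i ≠ w)
    (hinj : ∀ i j, a ≤ i → i < j → j ≤ b → z i ≠ z j)
    (h : ∀ i, a ≤ i → i ≤ b → ∃ m,
      R.TypedPiece D x (branch R.T x (z i)) (R.first x (z i)) m (R.first (z i) x)) :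
    ∃ m, R.TypedPiece D x (span R.T x z a b) (R.first x (z a)) m (R.first x (z (b + 1))) := by
  have hfirst : ∀ i, R.first (z i) x = R.first x (z (i + 1)) := by
    intro i
    rw [hstep, ← R.first_inner _ _ (hz i).symm hx]
  induction b, hab using Nat.le_induction with
  | base =>
    rw [span_self, ← hfirst]
    exact h a le_rfl le_rfl
  | succ b hab ih =>
    obtain ⟨m, hm⟩ := ih (fun i h1 h2 => hne i h1 (h2.trans (Nat.le_succ b)))
      (fun i j h1 h2 h3 => hinj i j h1 h2 (h3.trans (Nat.le_succ b)))
      (fun i h1 h2 => h i h1 (h2.trans (Nat.le_succ b)))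
    obtain ⟨m', hm'⟩ := h (b + 1) (hab.trans (Nat.le_succ b)) le_rfl
    rw [hfirst] at hm'
    obtain ⟨u, hu, hul⟩ := exists_leaf_mem_branch hw
    refine ⟨m', ?_⟩
    rw [span_succ _ _ _ hab]
    refine hm.append hD hm' (span_disjoint hz (hz _) fun i h1 h2 => hinj i _ h1 (by omega) le_rfl)
      ⟨u, hul, fun hus => ?_, fun hus => ?_⟩
    · exact Set.disjoint_left.1 (span_disjoint hz hw fun i h1 h2 =>
        hne i h1 (h2.trans (Nat.le_succ b))) hus hu
    · exact Set.disjoint_left.1 (branch_disjoint R.isTree (hz _) hw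
        (hne (b + 1) (hab.trans (Nat.le_succ b)) le_rfl)) hus hu

/-- The branch at `c x` consists of `x` and of the branches at the other neighbours of `x`. -/
theorem CyclicOrder.span_eq {c x : V} (h : R.T.Adj c x) {k : ℕ} {z : ℕ → V}
    (hz : R.CyclicOrder x c (k + 1) z) :
    span R.T x z 1 k = branch R.T c x \ {x} := by
  ext v
  constructor
  · rintro ⟨i, h1, h2, h3⟩
    refine ⟨branch_subset R.isTree h (hz.adj i) ?_ h3, ?_⟩
    · rw [← hz.last]
      exact hz.ne_of_lt (by omega) h1 le_rfl
    · rintro rfl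
      exact not_mem_branch h3
  · rintro ⟨hv, hvx⟩
    obtain ⟨y, hy, hyc, hvy⟩ := exists_mem_branch R.isTree hv hvx
    obtain ⟨i, hi, rfl⟩ := hz.surj y hy
    refine ⟨i, ?_, by omega, hvy⟩
    rcases i with _ | i
    · exact absurd hz.zero hyc
    · omega

theorem eq_adj_of_leaf {c x v : V} (h : R.T.Adj c x) (hx : IsLeaf R.T x) (hv : R.T.Adj x v) :
    v = c := by
  obtain ⟨p, hp⟩ := hx
  exact ((hp v).1 hv).trans ((hp c).1 h.symm).symm

theorem adj_of_arc {D : Digraph V} (hD : D.IsOrientationOf G) {x y : V} (h : D.Adj x y) :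
    G.Adj x y := by
  rw [← hD.2]
  refine ⟨?_, Or.inl h⟩
  rintro rfl
  exact hD.1 _ _ h h

/-- An inner vertex outside of a branch has no other edge to the branch than the edge of the
tree. -/
theorem not_adj_branch {D : Digraph V} (hD : D.IsOrientationOf G) {c x y : V} (hc : ¬ IsLeaf R.T c)
    (h : R.T.Adj c x) (hy : y ∈ branch R.T c x) (hyx : y ≠ x) : ¬ D.Adj c y ∧ ¬ D.Adj y c := by
  have hno : ¬ G.Adj c y := by
    intro hcy
    by_cases hT : R.T.Adj c y
    · rcases branch_closed R.isTree h hy hT.symm with h2 | ⟨h2, -⟩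
      · exact not_mem_branch h2
      · exact hyx h2
    · exact hc (R.adj c y hcy hT).1
  exact ⟨fun h2 => hno (adj_of_arc hD h2), fun h2 => hno (adj_of_arc hD h2).symm⟩

/-- Every branch is a piece with a type. If the vertex `x` next to `c` is not a leaf, then the rest
of the branch is a piece with a type that is attached to `x`. -/
theorem exists_typedPiece_branch [Finite V] {D : Digraph V} (hD : D.IsOrientationOf G) {c x : V}
    (hc : ¬ IsLeaf R.T c) (h : R.T.Adj c x) :
    ∃ m, R.TypedPiece D c (branch R.T c x) (R.first c x) m (R.first x c) ∧
      (¬ IsLeaf R.T x → R.TypedPiece D x (branch R.T c x \ {x}) (R.first c x) m (R.first x c)) := by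
  induction hn : (branch R.T c x).ncard using Nat.strong_induction_on generalizing c x with
  | _ n ih =>
    by_cases hx : IsLeaf R.T x
    · refine ⟨x, ⟨⟨?_, ?_, ?_, ?_, hx, ?_, ?_⟩, ?_, ?_⟩, fun h => absurd hx h⟩
      · exact not_mem_branch
      · exact fun u hu v huv => (branch_closed R.isTree h hu huv).imp_right And.right
      · rw [R.first_leaf c x h hx]
        exact mem_branch_self h
      · exact mem_branch_self h
      · rwa [R.first_leaf c x h hx]
      · intro u hu _ hux
        rw [branch_leaf R.isTree h hx] at hu
        exact absurd hu hux
      · exact (R.first_of_leaf x c h.symm hx).symm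
      · rw [R.first_leaf c x h hx, branch_leaf R.isTree h hx]
        exact ⟨_, _, signNat_mem_units _, hasType_leaf hD.1 h.ne⟩
    · obtain ⟨k, z, hz⟩ := exists_cyclicOrder hx h.symm
      obtain ⟨k, rfl⟩ : ∃ k', k = k' + 1 := ⟨k - 1, by have := hz.pos; omega⟩
      have hk : 1 ≤ k := by
        by_contra hk
        have hk : k = 0 := by omega
        subst hk
        refine hx ⟨c, fun w => ⟨fun hw => ?_, fun hw => hw ▸ h.symm⟩⟩
        obtain ⟨i, hi, rfl⟩ := hz.surj w hw
        rw [Nat.lt_one_iff.1 hi, hz.zero]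
      have hne : ∀ i, 1 ≤ i → i ≤ k → z i ≠ c := fun i h1 h2 => by
        rw [← hz.last]
        exact hz.ne_of_lt (by omega) h1 le_rfl
      obtain ⟨m, hm⟩ := typedPiece_span hD hx hz.adj hz.step hk h.symm hne
        (fun i j h1 h2 h3 => hz.ne_of_lt h2 h1 (by omega))
        (fun i h1 h2 => by
          obtain ⟨m, hm, -⟩ := ih _ (hn ▸ Set.ncard_lt_ncard
            (branch_ssubset R.isTree h (hz.adj i) (hne i h1 h2)) (Set.toFinite _)) hx (hz.adj i) rfl
          exact ⟨m, hm⟩)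
      have h1 : R.first x (z 1) = R.first c x := by
        rw [hz.step 0, hz.zero, ← R.first_inner c x h hx]
      rw [hz.last, h1, hz.span_eq h] at hm
      have hins : branch R.T c x = insert x (branch R.T c x \ {x}) := by
        rw [Set.insert_sdiff_singleton, Set.insert_eq_of_mem (mem_branch_self h)]
      have hcS : c ∉ branch R.T c x \ {x} := fun hc => not_mem_branch hc.1
      have hpiece := hm.toPiece.lift (p := c) hx (by rw [← hins]; exact not_mem_branch) (by
        intro v hv
        rcases branch_closed R.isTree h (mem_branch_self h) hv with h2 | ⟨-, h2⟩
        · exact Or.inl ⟨h2, hv.ne'⟩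
        · exact Or.inr h2)
      have htyped : Typed D c (insert x (branch R.T c x \ {x})) (R.first c x) m := by
        refine hm.typed.lift hD.1 hcS h.ne hm.first_mem hm.last_mem ?_
        exact fun y hy => not_adj_branch hD hc h hy.1 hy.2
      rw [← hins] at hpiece htyped
      exact ⟨m, { hpiece with succ_last := hm.succ_last, typed := htyped }, fun _ => hm⟩

end Frame
end HalinColoring

namespace HalinColoring

/-! ### Threads and hubs -/

/-- The branch at the edge `c x` is a path, with the leaf `y` at its end. -/
inductive IsThread {V : Type*} (T : SimpleGraph V) : V → V → V → Prop
  | leaf {c x : V} (h : T.Adj c x) (hx : IsLeaf T x) : IsThread T c x x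
  | step {c x x' y : V} (h : T.Adj c x) (hx : ¬ IsLeaf T x)
      (hN : ∀ w, T.Adj x w ↔ w = c ∨ w = x') (hne : x' ≠ c) (hy : IsThread T x x' y) :
      IsThread T c x y

section Thread

variable {V : Type*} {T : SimpleGraph V}

theorem IsThread.adj {c x y : V} (h : IsThread T c x y) : T.Adj c x := by
  cases h <;> assumption

theorem IsThread.isLeaf {c x y : V} (h : IsThread T c x y) : IsLeaf T y := by
  induction h with
  | leaf _ hx => exact hx
  | step _ _ _ _ _ ih => exact ih

theorem branch_eq_insert (hT : T.IsTree) {c x x' : V} (h : T.Adj c x)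
    (hN : ∀ w, T.Adj x w ↔ w = c ∨ w = x') (hne : x' ≠ c) :
    branch T c x = insert x (branch T x x') := by
  have hx' : T.Adj x x' := (hN x').2 (Or.inr rfl)
  ext v
  constructor
  · intro hv
    by_cases hvx : v = x
    · exact Or.inl hvx
    · obtain ⟨y, hy, hyc, hvy⟩ := exists_mem_branch hT hv hvx
      rcases (hN y).1 hy with rfl | rfl
      · exact absurd rfl hyc
      · exact Or.inr hvy
  · rintro (rfl | hv)
    · exact mem_branch_self h
    · exact branch_subset hT h hx' hne hv

theorem IsThread.mem_branch (hT : T.IsTree) {c x y : V} (h : IsThread T c x y) :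
    y ∈ branch T c x := by
  induction h with
  | leaf h _ => exact mem_branch_self h
  | step h hx hN hne _ ih =>
    rw [branch_eq_insert hT h hN hne]
    exact Or.inr ih

theorem IsThread.eq_of_isLeaf (hT : T.IsTree) {c x y v : V} (h : IsThread T c x y)
    (hv : v ∈ branch T c x) (hl : IsLeaf T v) : v = y := by
  induction h with
  | leaf h hx =>
    rw [branch_leaf hT h hx] at hv
    exact hv
  | step h hx hN hne _ ih =>
    rw [branch_eq_insert hT h hN hne] at hv
    rcases hv with rfl | hv
    · exact absurd hl hx
    · exact ih hv

/-- A vertex is a hub if it has at least three neighbours and all its branches but one are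
threads. Descending along branches that are not threads, one finds one. -/
theorem exists_hub_or_isThread [Finite V] (hT : T.IsTree) {c x : V} (h : T.Adj c x) :
    (∃ p y₀ a b, ¬ IsLeaf T p ∧ T.Adj p y₀ ∧ T.Adj p a ∧ T.Adj p b ∧ a ≠ y₀ ∧ b ≠ y₀ ∧ a ≠ b ∧
      ∀ w, T.Adj p w → w ≠ y₀ → ∃ y, IsThread T p w y) ∨ ∃ y, IsThread T c x y := by
  induction hn : (branch T c x).ncard using Nat.strong_induction_on generalizing c x with
  | _ n ih =>
    by_cases hx : IsLeaf T x
    · exact Or.inr ⟨x, .leaf h hx⟩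
    refine or_iff_not_imp_left.2 fun hno => ?_
    have hthread : ∀ w, T.Adj x w → w ≠ c → ∃ y, IsThread T x w y := fun w hw hwc =>
      (ih _ (hn ▸ Set.ncard_lt_ncard (branch_ssubset hT h hw hwc) (Set.toFinite _)) hw
        rfl).resolve_left hno
    obtain ⟨a, ha, hac⟩ : ∃ a, T.Adj x a ∧ a ≠ c := by
      by_contra! hno
      exact hx ⟨c, fun w => ⟨hno w, fun hw => hw ▸ h.symm⟩⟩
    by_cases hb : ∃ b, T.Adj x b ∧ b ≠ c ∧ a ≠ b
    · obtain ⟨b, hb, hbc, hab⟩ := hb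
      exact absurd ⟨x, c, a, b, hx, h.symm, ha, hb, hac, hbc, hab, hthread⟩ hno
    · push Not at hb
      obtain ⟨y, hy⟩ := hthread a ha hac
      refine ⟨y, .step h hx (fun w => ⟨fun hw => ?_, ?_⟩) hac hy⟩
      · by_cases hwc : w = c
        · exact Or.inl hwc
        · exact Or.inr (hb w hw hwc).symm
      · rintro (rfl | rfl)
        · exact h.symm
        · exact ha

end Thread

namespace Frame

variable {V : Type*} {G : SimpleGraph V} {R : Frame G} {D : Digraph V}

/-- The search for a hub starts at a leaf. The whole tree is not a thread, since it has three
leaves. -/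
theorem exists_hub [Finite V] (R : Frame G) :
    ∃ p y₀ a b, ¬ IsLeaf R.T p ∧ R.T.Adj p y₀ ∧ R.T.Adj p a ∧ R.T.Adj p b ∧ a ≠ y₀ ∧ b ≠ y₀ ∧
      a ≠ b ∧ ∀ w, R.T.Adj p w → w ≠ y₀ → ∃ y, IsThread R.T p w y := by
  have h3 := R.three_leaves
  have hne : {v | IsLeaf R.T v}.Nonempty := by
    rw [← Set.ncard_pos (Set.toFinite _)]
    omega
  obtain ⟨v, p, hp⟩ := hne
  have hvp : R.T.Adj v p := (hp p).2 rfl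
  refine (exists_hub_or_isThread R.isTree hvp).resolve_right ?_
  rintro ⟨y, hy⟩
  have hsub : {v | IsLeaf R.T v} ⊆ {v, y} := by
    intro u hu
    rcases mem_branch_or R.isTree hvp u with h | h
    · exact Or.inr (hy.eq_of_isLeaf R.isTree h hu)
    · rw [branch_leaf R.isTree hvp.symm ⟨p, hp⟩] at h
      exact Or.inl h
  have := (Set.ncard_le_ncard hsub (Set.toFinite _)).trans (Set.ncard_insert_le v {y})
  rw [Set.ncard_singleton] at this
  omega

/-- `T₇` has out-degree and in-degree `3`. -/
theorem exists_step_avoiding (s : Bool) (c u v : ZMod 7) : ∃ t, Step s c t ∧ t ≠ u ∧ t ≠ v := by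
  have : ∀ s : Bool, ∀ c u v : ZMod 7, ∃ t, (if s = true then (t - c = 1 ∨ t - c = 2 ∨ t - c = 4)
    else (c - t = 1 ∨ c - t = 2 ∨ c - t = 4)) ∧ t ≠ u ∧ t ≠ v := by decide +kernel
  exact this s c u v

/-- Any two different vertices of `T₇` are joined by a walk of length two with prescribed directions
of its arcs. -/
theorem exists_step_step (s s' : Bool) {c v : ZMod 7} (h : v ≠ c) :
    ∃ t, Step s c t ∧ Step s' t v := by
  have : ∀ s s' : Bool, ∀ c v : ZMod 7, v ≠ c →
    ∃ t, (if s = true then (t - c = 1 ∨ t - c = 2 ∨ t - c = 4)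
    else (c - t = 1 ∨ c - t = 2 ∨ c - t = 4)) ∧ (if s' = true then
      (v - t = 1 ∨ v - t = 2 ∨ v - t = 4) else (t - v = 1 ∨ t - v = 2 ∨ t - v = 4)) := by
    decide +kernel
  exact this s s' c v h

theorem homOn_insert_update [DecidableEq V] (hD : D.IsOriented) {f : V → ZMod 7} {S : Set V}
    (hf : HomOn D f S) {p : V} (hp : p ∉ S) {c : ZMod 7} (h : ∀ y ∈ S, Compat D p y c (f y)) :
    HomOn D (Function.update f p c) (insert p S) := by
  have hne : ∀ y ∈ S, y ≠ p := fun y hy h => hp (h ▸ hy)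
  rintro y (rfl | hy) z (rfl | hz) hyz
  · exact absurd hyz (hD _ _ hyz)
  · rw [Function.update_self, Function.update_of_ne (hne z hz)]
    exact (h z hz).1 hyz
  · rw [Function.update_self, Function.update_of_ne (hne y hy)]
    exact (h y hy).2 hyz
  · rw [Function.update_of_ne (hne y hy), Function.update_of_ne (hne z hz)]
    exact hf y hy z hz hyz

/-- The end of a thread with an inner vertex takes any colour that differs from the colour at
the other end. -/
theorem realizes_thread (hD : D.IsOrientationOf G) {c x y : V} (hc : ¬ IsLeaf R.T c)
    (h : IsThread R.T c x y) (hx : ¬ IsLeaf R.T x) {a v : ZMod 7} (hv : v ≠ a) :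
    Realizes D c (branch R.T c x) y y a v v := by
  induction h generalizing a with
  | leaf _ hl => exact absurd hl hx
  | @step c x x' y h _ hN hne hy ih =>
    have hx' := hy.adj
    have key : ∃ t, Step (dir D c x) a t ∧ Realizes D x (branch R.T x x') y y t v v := by
      by_cases hl : IsLeaf R.T x'
      · obtain ⟨t, h1, h2⟩ := exists_step_step (dir D c x) (dir D x x') hv
        refine ⟨t, h1, ?_⟩
        have hyx : y = x' := by
          have := hy.mem_branch R.isTree
          rwa [branch_leaf R.isTree hx' hl] at this
        rw [hyx, branch_leaf R.isTree hx' hl]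
        exact Realizes.leaf hD.1 hx'.ne (compat_of_step hD.1 h2)
      · obtain ⟨t, h1, h2, -⟩ := exists_step_avoiding (dir D c x) a v v
        exact ⟨t, h1, ih hx hl h2.symm⟩
    obtain ⟨t, h1, h2⟩ := key
    have hb := branch_eq_insert R.isTree h hN hne
    rw [hb]
    refine h2.lift hD.1 ?_ h.ne (hy.mem_branch R.isTree) (hy.mem_branch R.isTree) ?_
      (compat_of_step hD.1 h1)
    · intro hcm
      exact not_mem_branch (show c ∈ branch R.T c x from hb ▸ Or.inr hcm)
    · intro w hw
      refine not_adj_branch hD hc h (hb ▸ Or.inr hw) ?_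
      rintro rfl
      exact not_mem_branch hw

/-- A thread has the type of a single leaf. -/
theorem exists_hasType_thread (hD : D.IsOrientationOf G) {c x y : V} (hc : ¬ IsLeaf R.T c)
    (h : IsThread R.T c x y) :
    ∃ e, (IsLeaf R.T x → e = dir D c x) ∧ HasType D c (branch R.T c x) y y e (signNat e) := by
  by_cases hx : IsLeaf R.T x
  · have hyx : y = x := by
      have := h.mem_branch R.isTree
      rwa [branch_leaf R.isTree h.adj hx] at this
    refine ⟨_, fun _ => rfl, ?_⟩
    rw [hyx, branch_leaf R.isTree h.adj hx]
    exact hasType_leaf hD.1 h.adj.ne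
  · refine ⟨true, fun h => absurd h hx, fun a q hq => realizes_thread hD hc h hx ?_⟩
    have : ∀ q ∈ quads, ((signNat true * q : ℕ) : ZMod 7) ≠ 0 := by decide
    exact fun h => this q hq (by simpa using h)

/-- Without its last vertex, a thread can be coloured in such a way that the neighbour of the last
vertex avoids two given colours. -/
theorem exists_homOn_thread (hD : D.IsOrientationOf G) {c x y : V} (hc : ¬ IsLeaf R.T c)
    (h : IsThread R.T c x y) (hx : ¬ IsLeaf R.T x) (a u v : ZMod 7) :
    ∃ f, f c = a ∧ HomOn D f (insert c (branch R.T c x \ {y})) ∧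
      ∀ w, R.T.Adj y w → f w ≠ u ∧ f w ≠ v := by
  classical
  induction h generalizing a with
  | leaf _ hl => exact absurd hl hx
  | @step c x x' y h _ hN hne hy ih =>
    have hx' := hy.adj
    have hb := branch_eq_insert R.isTree h hN hne
    have hyb := hy.mem_branch R.isTree
    have hyx : y ≠ x := by
      rintro rfl
      exact not_mem_branch hyb
    have hcb : c ∉ branch R.T x x' := fun h => not_mem_branch
      (show c ∈ branch R.T c x from hb ▸ Or.inr h)
    have hset : branch R.T c x \ {y} = insert x (branch R.T x x' \ {y}) := by
      rw [hb, Set.insert_sdiff_of_notMem _ (show x ∉ ({y} : Set V) from fun h => hyx h.symm)]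
    have key : ∃ f : V → ZMod 7, Step (dir D c x) a (f x) ∧
        HomOn D f (insert x (branch R.T x x' \ {y})) ∧
        ∀ w, R.T.Adj y w → w ≠ c ∧ f w ≠ u ∧ f w ≠ v := by
      by_cases hl : IsLeaf R.T x'
      · obtain ⟨t, h1, h2⟩ := exists_step_avoiding (dir D c x) a u v
        have hyx : y = x' := by
          have := hy.mem_branch R.isTree
          rwa [branch_leaf R.isTree hx' hl] at this
        subst hyx
        refine ⟨fun _ => t, h1, ?_, fun w hw => ?_⟩
        · rw [branch_leaf R.isTree hx' hl]
          simp only [sdiff_self, Set.bot_eq_empty, insert_empty_eq]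
          rintro _ rfl _ rfl h
          exact absurd h (hD.1 _ _ h)
        · rw [eq_adj_of_leaf hx' hl hw]
          exact ⟨h.ne', h2⟩
      · obtain ⟨t, h1, -⟩ := exists_step_avoiding (dir D c x) a u v
        obtain ⟨f, rfl, h3, h4⟩ := ih hx hl t
        refine ⟨f, h1, h3, fun w hw => ⟨?_, h4 w hw⟩⟩
        rintro rfl
        rcases branch_closed R.isTree hx' hyb hw with h5 | ⟨-, h5⟩
        · exact hcb h5
        · exact h.ne h5
    obtain ⟨f, h1, h2, h3⟩ := key
    refine ⟨Function.update f c a, by simp, ?_, fun w hw => ?_⟩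
    · rw [hset]
      refine homOn_insert_update hD.1 h2 ?_ ?_
      · rintro (rfl | h)
        · exact h.ne rfl
        · exact hcb h.1
      · rintro w (rfl | hw)
        · exact compat_of_step hD.1 h1
        · have hwx : w ≠ x := by
            rintro rfl
            exact not_mem_branch hw.1
          have := not_adj_branch hD hc h (hb ▸ Or.inr hw.1) hwx
          exact ⟨fun h => absurd h this.1, fun h => absurd h this.2⟩
    · rw [Function.update_of_ne (h3 w hw).1]
      exact (h3 w hw).2

end Frame
end HalinColoring

namespace HalinColoring

/-! ### One vertex of the additional colour -/

/-- All vertices but `y` can be coloured by a homomorphism to `T₇` in such a way that no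
in-neighbour of `y` has the colour of an out-neighbour. -/
def ColorableBut {V : Type*} (D : Digraph V) (y : V) : Prop :=
  ∃ f : V → ZMod 7, HomOn D f {y}ᶜ ∧ ∀ w w', D.Adj w y → D.Adj y w' → f w ≠ f w'

/-- The additional colour is used for the vertex `y` only, so that its arcs can be chosen freely. -/
theorem ColorableBut.exists_hom {V : Type*} {D : Digraph V} (hD : D.IsOriented) {y : V}
    (h : ColorableBut D y) :
    ∃ H : Digraph (Option (ZMod 7)), H.IsOriented ∧
      (∀ i j : ZMod 7, H.Adj (some i) (some j) ↔ Digraph.T7.Adj i j) ∧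
      Nonempty (D.Adj →r H.Adj) := by
  classical
  obtain ⟨f, hf, hy⟩ := h
  let A : Option (ZMod 7) → Option (ZMod 7) → Prop
    | some i, some j => Digraph.T7.Adj i j
    | none, some j => ∃ w, D.Adj y w ∧ f w = j
    | some i, none => ∃ w, D.Adj w y ∧ f w = i
    | none, none => False
  refine ⟨⟨A⟩, ?_, fun i j => Iff.rfl, ⟨⟨fun x => if x = y then none else some (f x), ?_⟩⟩⟩
  · have hT : ∀ i j : ZMod 7, j - i = 1 ∨ j - i = 2 ∨ j - i = 4 →
        ¬ (i - j = 1 ∨ i - j = 2 ∨ i - j = 4) := by decide +kernel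
    rintro (_ | i) (_ | j) h h'
    · exact h
    · obtain ⟨w, h1, h2⟩ := h
      obtain ⟨w', h3, h4⟩ := h'
      exact hy w' w h3 h1 (h4.trans h2.symm)
    · obtain ⟨w, h1, h2⟩ := h
      obtain ⟨w', h3, h4⟩ := h'
      exact hy w w' h1 h3 (h2.trans h4.symm)
    · exact hT i j h h'
  · intro a b hab
    by_cases ha : a = y <;> by_cases hb : b = y
    · subst ha hb
      exact absurd hab (hD _ _ hab)
    · subst ha
      simp only [if_true, if_neg hb]
      exact ⟨b, hab, rfl⟩
    · subst hb
      simp only [if_true, if_neg ha]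
      exact ⟨a, hab, rfl⟩
    · simp only [if_neg ha, if_neg hb]
      exact hf a ha b hb hab

theorem orientedColorable_of_hom {V W : Type*} [Fintype W] {D : Digraph V} {H : Digraph W}
    (hH : H.IsOriented) (g : D.Adj →r H.Adj) {k : ℕ} (hk : Fintype.card W = k) :
    D.OrientedColorable k := by
  let e := Fintype.equivFinOfCardEq hk
  refine ⟨fun v => e (g v), fun u v huv h => ?_, fun t u v w htu hvw => ?_⟩
  · have h1 := g.map_rel huv
    rw [e.injective h] at h1
    exact hH _ _ h1 h1
  · by_contra! h
    have h1 := g.map_rel htu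
    rw [e.injective h.1, e.injective h.2] at h1
    exact hH _ _ h1 (g.map_rel hvw)

namespace Frame

variable {V : Type*} {G : SimpleGraph V} {R : Frame G} {D : Digraph V}

/-- The map `succ` is surjective on the finite set of leaves. -/
theorem succ_injOn [Finite V] (R : Frame G) : Set.InjOn R.succ {v | IsLeaf R.T v} := by
  refine Set.Finite.injOn_of_encard_image_eq (Set.toFinite _) ?_
  congr 1
  ext v
  constructor
  · rintro ⟨u, hu, rfl⟩
    exact R.succ_leaf u hu
  · intro hv
    obtain ⟨k, hk⟩ := R.succ_cyclic (R.succ v) v (R.succ_leaf v hv) hv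
    rw [← Function.iterate_succ_apply, Function.iterate_succ_apply'] at hk
    have : ∀ k, IsLeaf R.T (R.succ^[k] v) := by
      intro k
      induction k with
      | zero => exact hv
      | succ k ih =>
        rw [Function.iterate_succ_apply']
        exact R.succ_leaf _ ih
    exact ⟨_, this k, hk⟩

/-- In `G`, a leaf `y` is adjacent to its neighbour in the tree and to the leaves before and after
it. -/
theorem adj_leaf [Finite V] (hD : D.IsOrientationOf G) {y m w : V} (hm : IsLeaf R.T m)
    (hmy : R.succ m = y) (h : D.Adj y w ∨ D.Adj w y) :
    R.T.Adj y w ∨ w = R.succ y ∨ w = m := by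
  have hG : G.Adj y w := h.elim (adj_of_arc hD) fun h => (adj_of_arc hD h).symm
  refine or_iff_not_imp_left.2 fun hT => ?_
  obtain ⟨h1, h2, h3⟩ := R.adj y w hG hT
  exact h3.imp_right fun h3 => R.succ_injOn h2 hm (h3.symm.trans hmy.symm)

/-- A thread can be completed, with the additional colour for its leaf `y`, once the rest of the
graph is coloured and the colours of the neighbours of `y` on the external cycle are in order. -/
theorem colorableBut_of_thread [Finite V] (hD : D.IsOrientationOf G) {p x y : V}
    (hp : ¬ IsLeaf R.T p) (h : IsThread R.T p x y) {W : Set V} {l m : V} (hl : R.succ y = l)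
    (hml : IsLeaf R.T m) (hm : R.succ m = y) (hlW : l ∈ W) (hmW : m ∈ W) (hpW : p ∉ W)
    (hdisj : Disjoint W (branch R.T p x)) (hcov : ∀ v, v = p ∨ v ∈ W ∨ v ∈ branch R.T p x)
    {e : Bool} (he : IsLeaf R.T x → e = dir D p x) {c : ZMod 7} {l' m' : ℕ}
    (hR : Realizes D p W l m c (c + l') (c + m'))
    (hn : noConflict e (dir D m y) (dir D y l) l' m' = true) : ColorableBut D y := by
  classical
  simp only [noConflict, Bool.and_eq_true, Bool.or_eq_true, beq_iff_eq, Bool.not_eq_true',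
    bne_iff_ne, ← Bool.not_eq_true, eqNat_iff, Nat.cast_zero] at hn
  obtain ⟨⟨hn1, hn2⟩, hn3⟩ := hn
  obtain ⟨f, hfp, hfl, hfm, hf⟩ := hR
  have hWb : ∀ v ∈ W, v ∉ branch R.T p x := fun v hv => Set.disjoint_left.1 hdisj hv
  have hnot : ∀ a b, D.Adj a b → ¬ D.Adj b a := hD.1
  -- it suffices to find a colouring for which the tree-neighbour of `y` is in order, too
  have key : ∀ g : V → ZMod 7, HomOn D g {y}ᶜ → g l = f l → g m = f m →
      (∀ t, R.T.Adj y t →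
        ((D.Adj t y ∧ D.Adj y l ∨ D.Adj l y ∧ D.Adj y t) → g t ≠ g l) ∧
        ((D.Adj t y ∧ D.Adj y m ∨ D.Adj m y ∧ D.Adj y t) → g t ≠ g m)) → ColorableBut D y := by
    intro g hg hgl hgm ht
    have hlm : (D.Adj m y ∧ D.Adj y l ∨ D.Adj l y ∧ D.Adj y m) → g m ≠ g l := by
      intro h1 h2
      rw [hgl, hgm, hfl, hfm] at h2
      refine hn3.elim (fun h3 => h3 ?_) fun h3 => h3 (add_left_cancel h2).symm
      rcases h1 with ⟨h4, h5⟩ | ⟨h4, h5⟩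
      · simp [dir, h4, h5]
      · simp [dir, hnot _ _ h4, hnot _ _ h5]
    refine ⟨g, hg, fun w w' hw hw' => ?_⟩
    have h1 := adj_leaf hD hml hm (Or.inr hw)
    have h2 := adj_leaf hD hml hm (Or.inl hw')
    rw [hl] at h1 h2
    rcases h1 with h1 | rfl | rfl <;> rcases h2 with h2 | rfl | rfl
    · have := eq_adj_of_leaf h1.symm h.isLeaf h2
      subst this
      exact absurd hw' (hnot _ _ hw)
    · exact (ht w h1).1 (Or.inl ⟨hw, hw'⟩)
    · exact (ht w h1).2 (Or.inl ⟨hw, hw'⟩)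
    · exact ((ht w' h2).1 (Or.inr ⟨hw, hw'⟩)).symm
    · exact absurd hw' (hnot _ _ hw)
    · exact (hlm (Or.inr ⟨hw, hw'⟩)).symm
    · exact ((ht w' h2).2 (Or.inr ⟨hw, hw'⟩)).symm
    · exact hlm (Or.inl ⟨hw, hw'⟩)
    · exact absurd hw' (hnot _ _ hw)
  by_cases hx : IsLeaf R.T x
  · have hyx : y = x := by
      have := h.mem_branch R.isTree
      rwa [branch_leaf R.isTree h.adj hx] at this
    subst hyx
    rw [he hx] at hn1 hn2
    refine key f (fun a ha b hb hab => ?_) rfl rfl fun t ht => ?_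
    · have : ∀ a ∈ ({y}ᶜ : Set V), a ∈ insert p W := by
        intro a ha
        rcases hcov a with h1 | h1 | h1
        · exact Or.inl h1
        · exact Or.inr h1
        · rw [branch_leaf R.isTree h.adj hx] at h1
          exact absurd h1 ha
      exact hf a (this a ha) b (this b hb) hab
    · have := eq_adj_of_leaf h.adj hx ht
      subst this
      rw [hfp, hfl, hfm]
      constructor
      · intro h1 h2
        have h2 : (l' : ZMod 7) = 0 := by simpa using h2.symm
        refine hn2.elim (fun h3 => h3 ?_) fun h3 => h3 h2
        rcases h1 with ⟨h4, h5⟩ | ⟨h4, h5⟩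
        · simp [dir, h4, h5]
        · simp [dir, hnot _ _ h4, hnot _ _ h5]
      · intro h1 h2
        have h2 : (m' : ZMod 7) = 0 := by simpa using h2.symm
        refine hn1.elim (fun h3 => ?_) fun h3 => h3 h2
        rcases h1 with ⟨h4, h5⟩ | ⟨h4, h5⟩
        · simp [dir, h4, hnot _ _ h5] at h3
        · simp [dir, h4, hnot _ _ h5] at h3
  · obtain ⟨f', hfp', hf', ht⟩ := exists_homOn_thread hD hp h hx c (f l) (f m)
    have hpb : p ∉ branch R.T p x := not_mem_branch
    have hcross : ∀ a ∈ W, ∀ b ∈ branch R.T p x, b ≠ y → ¬ D.Adj a b ∧ ¬ D.Adj b a := by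
      intro a ha b hb hby
      have hno : ¬ G.Adj b a := by
        intro hba
        by_cases hT : R.T.Adj b a
        · rcases branch_closed R.isTree h.adj hb hT with h1 | ⟨rfl, rfl⟩
          · exact hWb a ha h1
          · exact hpW ha
        · exact hby (h.eq_of_isLeaf R.isTree hb (R.adj b a hba hT).1)
      exact ⟨fun h => hno (adj_of_arc hD h).symm, fun h => hno (adj_of_arc hD h)⟩
    refine key (fun v => if v ∈ branch R.T p x then f' v else f v) (fun a ha b hb hab => ?_)
      (if_neg (hWb l hlW)) (if_neg (hWb m hmW)) fun t htt => ?_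
    · have hcases : ∀ a ∈ ({y}ᶜ : Set V), a = p ∨ a ∈ W ∨ a ∈ branch R.T p x \ {y} := by
        intro a ha
        rcases hcov a with h1 | h1 | h1
        · exact Or.inl h1
        · exact Or.inr (Or.inl h1)
        · exact Or.inr (Or.inr ⟨h1, ha⟩)
      rcases hcases a ha with rfl | ha | ha <;> rcases hcases b hb with rfl | hb | hb
      · exact absurd hab (hnot _ _ hab)
      · simpa [hpb, hWb b hb] using hf _ (Or.inl rfl) b (Or.inr hb) hab
      · simpa [hpb, hb.1, hfp, hfp'] using hf' _ (Or.inl rfl) b (Or.inr hb) hab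
      · simpa [hpb, hWb a ha] using hf a (Or.inr ha) _ (Or.inl rfl) hab
      · simpa [hWb a ha, hWb b hb] using hf a (Or.inr ha) b (Or.inr hb) hab
      · exact absurd hab (hcross a ha b hb.1 hb.2).1
      · simpa [hpb, ha.1, hfp, hfp'] using hf' a (Or.inr ha) _ (Or.inl rfl) hab
      · exact absurd hab (hcross b hb a ha.1 ha.2).2
      · simpa [ha.1, hb.1] using hf' a (Or.inr ha) b (Or.inr hb) hab
    · have htb : t ∈ branch R.T p x := by
        rcases branch_closed R.isTree h.adj (h.mem_branch R.isTree) htt with h1 | ⟨rfl, -⟩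
        · exact h1
        · exact absurd h.isLeaf hx
      simp only [if_pos htb, if_neg (hWb l hlW), if_neg (hWb m hmW)]
      exact ⟨fun _ => (ht t htt).1, fun _ => (ht t htt).2⟩

end Frame
end HalinColoring

namespace HalinColoring
namespace Frame

variable {V : Type*} {G : SimpleGraph V} {R : Frame G} {D : Digraph V}

/-! ### Colouring from a hub -/

/-- A piece with a colouring of it, where `l'` is the leaf after the piece. The colours `u` and `v`
are relative to the colour `c` of `p`. -/
structure ColoredPiece (R : Frame G) (D : Digraph V) (p : V) (S : Set V) (l m l' : V)
    (c : ZMod 7) (u v : ℕ) : Prop extends R.Piece p S l m where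
  succ_last : R.succ m = l'
  realizes : Realizes D p S l m c (c + u) (c + v)

theorem ColoredPiece.append (hD : D.IsOrientationOf G) {p : V} {S S' : Set V}
    {l m l' m' l'' : V} {c : ZMod 7} {u v u' v' : ℕ} (h : R.ColoredPiece D p S l m l' c u v)
    (h' : R.ColoredPiece D p S' l' m' l'' c u' v') (hd : Disjoint S S')
    (ho : ∃ u, IsLeaf R.T u ∧ u ∉ S ∪ S') (hs : stepNat (dir D m l') v u' = true) :
    R.ColoredPiece D p (S ∪ S') l m' l'' c u v' :=
  { h.toPiece.append h'.toPiece h.succ_last with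
    succ_last := h'.succ_last
    realizes := h.realizes.append h'.realizes hd h'.notMem h.first_mem h.last_mem h'.first_mem
      h'.last_mem (h.toPiece.onlyEdge hD h'.toPiece hd h.succ_last
        (ho.imp fun _ hu => ⟨hu.1, fun h => hu.2 (Or.inl h), fun h => hu.2 (Or.inr h)⟩))
      (compat_of_step hD.1 (step_of_stepNat hs c)) }

theorem TypedPiece.exists_coloredPiece {p : V} {S : Set V} {l m l' : V}
    (h : R.TypedPiece D p S l m l') (c : ZMod 7) : ∃ α, ∃ b ∈ units,
      R.ColoredPiece D p S l m l' c (signNat α) b := by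
  obtain ⟨α, b, hb, ht⟩ := h.typed
  refine ⟨α, b, hb, { h.toPiece with succ_last := h.succ_last, realizes := ?_ }⟩
  simpa using ht c 1 (by simp [quads])

theorem _root_.HalinColoring.IsThread.eq_first [Finite V] (hD : D.IsOrientationOf G) {p x y : V}
    (hp : ¬ IsLeaf R.T p) (h : IsThread R.T p x y) : y = R.first p x := by
  obtain ⟨m, hm, -⟩ := exists_typedPiece_branch hD hp h.adj
  exact (h.eq_of_isLeaf R.isTree hm.first_mem hm.first_leaf).symm

/-- A thread is a piece whose first and last leaf coincide. -/
theorem exists_coloredPiece_thread [Finite V] (hD : D.IsOrientationOf G) {p x y : V}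
    (hp : ¬ IsLeaf R.T p) (h : IsThread R.T p x y) : ∃ e, (IsLeaf R.T x → e = dir D p x) ∧
      ∀ c, ∀ q ∈ quads, R.ColoredPiece D p (branch R.T p x) y y (R.first x p) c
        (signNat e * q) (signNat e * q) := by
  obtain ⟨e, he, ht⟩ := exists_hasType_thread hD hp h
  obtain ⟨m, hm, -⟩ := exists_typedPiece_branch hD hp h.adj
  have h1 := h.eq_of_isLeaf R.isTree hm.first_mem hm.first_leaf
  have h2 := h.eq_of_isLeaf R.isTree hm.last_mem hm.last_leaf
  rw [h1, h2] at hm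
  exact ⟨e, he, fun c q hq =>
    { hm.toPiece with succ_last := hm.succ_last, realizes := ht c q hq }⟩

/-- The colourings of the branch at `p x`, where `t` is the colour of `x` relative to that of `p`.
-/
theorem exists_coloredPiece_inner [Finite V] (hD : D.IsOrientationOf G) {p x : V}
    (hp : ¬ IsLeaf R.T p) (hx : ¬ IsLeaf R.T x) (h : R.T.Adj p x) :
    ∃ m α, ∃ b ∈ units, ∀ c, ∀ t, stepNat (dir D p x) 0 t = true → ∀ q ∈ quads,
      R.ColoredPiece D p (branch R.T p x) (R.first p x) m (R.first x p) c
        (t + signNat α * q) (t + b * q) := by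
  obtain ⟨m, hm, hm'⟩ := exists_typedPiece_branch hD hp h
  replace hm' := hm' hx
  obtain ⟨α, b, hb, ht⟩ := hm'.typed
  refine ⟨m, α, b, hb, fun c t hst q hq =>
    { hm.toPiece with succ_last := hm.succ_last, realizes := ?_ }⟩
  have := ht.realizes_lift hD.1 (p := p) (fun hc => not_mem_branch hc.1) h.ne hm'.first_mem
    hm'.last_mem (fun y hy => not_adj_branch hD hp h hy.1 hy.2) c hq hst
  rwa [Set.insert_sdiff_singleton, Set.insert_eq_of_mem (mem_branch_self h)] at this

/-- If the piece `W` is all of the graph but `p` and the thread at `x`, then the additional colour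
can be used for the end of this thread. -/
theorem ColoredPiece.colorableBut [Finite V] (hD : D.IsOrientationOf G) {p x y : V}
    (hp : ¬ IsLeaf R.T p) (h : IsThread R.T p x y) {W : Set V} {l m : V} {c : ZMod 7} {u v : ℕ}
    (hW : R.ColoredPiece D p W l m y c u v) (hl : R.succ y = l)
    (hdisj : Disjoint W (branch R.T p x)) (hcov : ∀ v, v = p ∨ v ∈ W ∨ v ∈ branch R.T p x)
    {e : Bool} (he : IsLeaf R.T x → e = dir D p x)
    (hn : noConflict e (dir D m y) (dir D y l) u v = true) : ColorableBut D y :=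
  colorableBut_of_thread hD hp h hl hW.last_leaf hW.succ_last hW.first_mem hW.last_mem
    hW.notMem hdisj hcov he hW.realizes hn

namespace CyclicOrder

variable {p y : V} {k : ℕ} {z : ℕ → V}

theorem three_le (h : R.CyclicOrder p y k z) {a b : V} (ha : R.T.Adj p a) (hb : R.T.Adj p b)
    (hay : a ≠ y) (hby : b ≠ y) (hab : a ≠ b) : 3 ≤ k := by
  obtain ⟨i, hi, rfl⟩ := h.surj a ha
  obtain ⟨j, hj, rfl⟩ := h.surj b hb
  have h1 : i ≠ 0 := by
    rintro rfl
    exact hay h.zero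
  have h2 : j ≠ 0 := by
    rintro rfl
    exact hby h.zero
  have h3 : i ≠ j := by
    rintro rfl
    exact hab rfl
  omega

theorem first_symm (h : R.CyclicOrder p y k z) (hp : ¬ IsLeaf R.T p) (i : ℕ) :
    R.first (z i) p = R.first p (z (i + 1)) := by
  rw [h.step, ← R.first_inner _ _ (h.adj i).symm hp]

theorem eq_one (h : R.CyclicOrder p y k z) : z (k + 1) = z 1 := by
  rw [h.step, h.last, ← h.zero, ← h.step]

theorem branch_disjoint (h : R.CyclicOrder p y k z) {i j : ℕ} (hi : i ∈ Set.Icc 1 k)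
    (hj : j ∈ Set.Icc 1 k) (hij : i ≠ j) :
    Disjoint (branch R.T p (z i)) (branch R.T p (z j)) := by
  refine HalinColoring.branch_disjoint R.isTree (h.adj i) (h.adj j) ?_
  rcases lt_or_gt_of_ne hij with hlt | hlt
  · exact h.ne_of_lt hlt hi.1 hj.2
  · exact (h.ne_of_lt hlt hj.1 hi.2).symm

theorem span_disjoint (h : R.CyclicOrder p y k z) {a b j : ℕ} (ha : 1 ≤ a) (hb : b ≤ k)
    (hj : j ∈ Set.Icc 1 k) (hab : j < a ∨ b < j) :
    Disjoint (span R.T p z a b) (branch R.T p (z j)) := by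
  rw [Set.disjoint_left]
  rintro v ⟨i, h1, h2, h3⟩
  exact Set.disjoint_left.1 (h.branch_disjoint ⟨ha.trans h1, h2.trans hb⟩ hj (by omega)) h3

theorem cover (h : R.CyclicOrder p y k z) (v : V) :
    v = p ∨ ∃ i ∈ Set.Icc 1 k, v ∈ branch R.T p (z i) := by
  refine or_iff_not_imp_left.2 fun hv => ?_
  rcases mem_branch_or R.isTree (h.adj k) v with h1 | h1
  · exact ⟨k, ⟨h.pos, le_rfl⟩, h1⟩
  · obtain ⟨w, hw, hne, hvw⟩ := exists_mem_branch R.isTree h1 hv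
    obtain ⟨i, hi, rfl⟩ := h.surj w hw
    have h0 : i ≠ 0 := by
      rintro rfl
      exact hne (h.zero.trans h.last.symm)
    exact ⟨i, ⟨by omega, hi.le⟩, hvw⟩

theorem exists_typedPiece_span [Finite V] (h : R.CyclicOrder p y k z) (hD : D.IsOrientationOf G)
    (hp : ¬ IsLeaf R.T p) {a b : ℕ} (ha : 1 ≤ a) (hab : a ≤ b) (hb : b ≤ k)
    (hne : ∃ j ∈ Set.Icc 1 k, j < a ∨ b < j) : ∃ m,
      R.TypedPiece D p (span R.T p z a b) (R.first p (z a)) m (R.first p (z (b + 1))) := by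
  obtain ⟨j, hj, hj'⟩ := hne
  refine typedPiece_span hD hp h.adj h.step hab (h.adj j) (fun i h1 h2 => ?_)
    (fun i j h1 h2 h3 => h.ne_of_lt h2 (by omega) (by omega)) fun i _ _ => ?_
  · rcases hj' with h3 | h3
    · exact (h.ne_of_lt (by omega) hj.1 (by omega)).symm
    · exact h.ne_of_lt (by omega) (by omega) hj.2
  · obtain ⟨m, hm, -⟩ := exists_typedPiece_branch hD hp (h.adj i)
    exact ⟨m, hm⟩

end CyclicOrder

/-- The vertex of the additional colour can be chosen as the end of one of the two threads next to
the exceptional branch of a hub, if this branch is not just a leaf. -/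
theorem exists_colorableBut_of_inner [Finite V] (hD : D.IsOrientationOf G) {p x a b : V}
    (hp : ¬ IsLeaf R.T p) (hx : ¬ IsLeaf R.T x) (hpx : R.T.Adj p x) (ha : R.T.Adj p a)
    (hb : R.T.Adj p b) (hax : a ≠ x) (hbx : b ≠ x) (hab : a ≠ b)
    (hthread : ∀ w, R.T.Adj p w → w ≠ x → ∃ y, IsThread R.T p w y) :
    ∃ y, ColorableBut D y := by
  obtain ⟨k, z, hz⟩ := exists_cyclicOrder hp hpx
  obtain ⟨n, rfl⟩ : ∃ n, k = n + 3 := ⟨k - 3, by have := hz.three_le ha hb hax hbx hab; omega⟩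
  have ht : ∀ i, 1 ≤ i → i ≤ n + 2 → IsThread R.T p (z i) (R.first p (z i)) := by
    intro i h1 h2
    obtain ⟨y, hy⟩ := hthread (z i) (hz.adj i) (by
      rw [← hz.last]
      exact hz.ne_of_lt (by omega) h1 le_rfl)
    rwa [← hy.eq_first hD hp]
  have hleaf : ∀ i, 1 ≤ i → i ≤ n + 2 → ∀ W, Disjoint W (branch R.T p (z i)) →
      ∃ u, IsLeaf R.T u ∧ u ∉ W := fun i h1 h2 W hW =>
    ⟨_, (ht i h1 h2).isLeaf, fun h =>
      Set.disjoint_left.1 hW h ((ht i h1 h2).mem_branch R.isTree)⟩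
  obtain ⟨e₁, he₁, hY₁⟩ := exists_coloredPiece_thread hD hp (ht 1 le_rfl (by omega))
  obtain ⟨e₂, he₂, hY₂⟩ := exists_coloredPiece_thread hD hp (ht (n + 2) (by omega) le_rfl)
  rw [hz.first_symm hp] at hY₁ hY₂
  -- the exceptional branch, which both precedes the first thread and follows the last one
  obtain ⟨mS, α, β, hβ, hS⟩ := exists_coloredPiece_inner hD hp hx hpx
  have hl := hz.first_symm hp
  have hS' := hl (n + 3)
  rw [hz.last, hz.eq_one] at hS'
  rw [hS'] at hS
  have hx3 : x = z (n + 3) := hz.last.symm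
  rw [hx3] at hS
  have hI : ∀ i, 1 ≤ i → i ≤ n + 3 → i ∈ Set.Icc 1 (n + 3) := fun i h1 h2 => ⟨h1, h2⟩
  have hsucc : ∀ i, 1 ≤ i → i ≤ n + 2 → R.succ (R.first p (z i)) = R.first p (z (i + 1)) := by
    intro i h1 h2
    obtain ⟨e, -, hY⟩ := exists_coloredPiece_thread hD hp (ht i h1 h2)
    rw [hl] at hY
    exact (hY 0 1 (by simp [quads])).succ_last
  have d1 := hz.branch_disjoint (i := 1) (j := n + 2) (hI _ (by omega) (by omega))
    (hI _ (by omega) (by omega)) (by omega)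
  have d2 := hz.branch_disjoint (i := 1) (j := n + 3) (hI _ (by omega) (by omega))
    (hI _ (by omega) (by omega)) (by omega)
  have d3 := hz.branch_disjoint (i := n + 2) (j := n + 3) (hI _ (by omega) (by omega))
    (hI _ (by omega) (by omega)) (by omega)
  rcases Nat.eq_zero_or_pos n with rfl | hn
  -- there are only two threads
  · have hc := hub_check_two
    simp only [List.all_eq_true, List.any_eq_true, Bool.and_eq_true, Bool.or_eq_true] at hc
    rcases hc α (mem_signs _) β hβ (dir D p (z (0 + 3))) (mem_signs _) e₁ (mem_signs _) e₂
      (mem_signs _) (dir D mS (R.first p (z 1))) (mem_signs _)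
      (dir D (R.first p (z 1)) (R.first p (z 2))) (mem_signs _)
      (dir D (R.first p (z 2)) (R.first p (z 3))) (mem_signs _) with
      ⟨q₂, hq₂, t, -, h1, q₃, hq₃, h2, h3⟩ | ⟨q₁, hq₁, t, -, h1, q₃, hq₃, h2, h3⟩
    -- the end of the first thread is removed
    · have hW := (hY₂ 0 q₂ hq₂).append hD (hS 0 t h1 q₃ hq₃) d3 (hleaf 1 le_rfl (by omega) _
        (Set.disjoint_union_left.2 ⟨d1.symm, d2.symm⟩)) h2
      refine ⟨_, hW.colorableBut hD hp (ht 1 le_rfl (by omega)) (hsucc 1 le_rfl (by omega))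
        (Set.disjoint_union_left.2 ⟨d1.symm, d2.symm⟩) (fun v => ?_) he₁ h3⟩
      rcases hz.cover v with h4 | ⟨i, hi, h4⟩
      · exact Or.inl h4
      · obtain rfl | rfl | rfl : i = 1 ∨ i = 0 + 2 ∨ i = 0 + 3 := by
          have := hi.1; have := hi.2; omega
        · exact Or.inr (Or.inr h4)
        · exact Or.inr (Or.inl (Or.inl h4))
        · exact Or.inr (Or.inl (Or.inr h4))
    -- the end of the last thread is removed
    · have hW := (hS 0 t h1 q₃ hq₃).append hD (hY₁ 0 q₁ hq₁) d2.symm (hleaf (0 + 2) (by omega)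
        (by omega) _ (Set.disjoint_union_left.2 ⟨d3.symm, d1⟩)) h2
      refine ⟨_, hW.colorableBut hD hp (ht (0 + 2) (by omega) (by omega))
        (hsucc (0 + 2) (by omega) (by omega))
        (Set.disjoint_union_left.2 ⟨d3.symm, d1⟩) (fun v => ?_) he₂ h3⟩
      rcases hz.cover v with h4 | ⟨i, hi, h4⟩
      · exact Or.inl h4
      · obtain rfl | rfl | rfl : i = 1 ∨ i = 0 + 2 ∨ i = 0 + 3 := by
          have := hi.1; have := hi.2; omega
        · exact Or.inr (Or.inl (Or.inr h4))
        · exact Or.inr (Or.inr h4)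
        · exact Or.inr (Or.inl (Or.inl h4))
  -- the threads between the first and the last one are combined to a piece
  · obtain ⟨mM, hM⟩ := hz.exists_typedPiece_span hD hp (a := 2) (b := n + 1) (by omega) (by omega)
      (by omega) ⟨1, hI _ le_rfl (by omega), Or.inl (by omega)⟩
    obtain ⟨α', β', hβ', hM⟩ := hM.exists_coloredPiece 0
    have s1 := hz.span_disjoint (a := 2) (b := n + 1) (j := 1) (by omega) (by omega)
      (hI _ (by omega) (by omega)) (by omega)
    have s2 := hz.span_disjoint (a := 2) (b := n + 1) (j := n + 2) (by omega) (by omega)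
      (hI _ (by omega) (by omega)) (by omega)
    have s3 := hz.span_disjoint (a := 2) (b := n + 1) (j := n + 3) (by omega) (by omega)
      (hI _ (by omega) (by omega)) (by omega)
    have hc := hub_check_three
    simp only [List.all_eq_true, List.any_eq_true, Bool.and_eq_true, Bool.or_eq_true] at hc
    rcases hc α (mem_signs _) β hβ (dir D p (z (n + 3))) (mem_signs _) e₁ (mem_signs _) e₂
      (mem_signs _) α' (mem_signs _) β' hβ' (dir D mS (R.first p (z 1))) (mem_signs _)
      (dir D (R.first p (z 1)) (R.first p (z 2))) (mem_signs _)
      (dir D mM (R.first p (z (n + 2)))) (mem_signs _)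
      (dir D (R.first p (z (n + 2))) (R.first p (z (n + 3)))) (mem_signs _) with
      ⟨q₂, hq₂, h0, t, -, h1, q₃, hq₃, h2, h3⟩ | ⟨q₁, hq₁, h0, t, -, h1, q₃, hq₃, h2, h3⟩
    · have hd : Disjoint (span R.T p z 2 (n + 1) ∪ branch R.T p (z (n + 2)) ∪
          branch R.T p (z (n + 3))) (branch R.T p (z 1)) :=
        Set.disjoint_union_left.2 ⟨Set.disjoint_union_left.2 ⟨s1, d1.symm⟩, d2.symm⟩
      have hd' := (Set.disjoint_union_left.1 hd).1
      have hW := (hM.append hD (hY₂ 0 q₂ hq₂) s2 (hleaf 1 le_rfl (by omega) _ hd') h0).append hD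
        (hS 0 t h1 q₃ hq₃) (Set.disjoint_union_left.2 ⟨s3, d3⟩)
        (hleaf 1 le_rfl (by omega) _ hd) h2
      refine ⟨_, hW.colorableBut hD hp (ht 1 le_rfl (by omega)) (hsucc 1 le_rfl (by omega))
        hd (fun v => ?_) he₁ h3⟩
      rcases hz.cover v with h4 | ⟨i, hi, h4⟩
      · exact Or.inl h4
      · have h5 := hi.1
        have h6 := hi.2
        obtain rfl | h7 | rfl | rfl : i = 1 ∨ (2 ≤ i ∧ i ≤ n + 1) ∨ i = n + 2 ∨ i = n + 3 := by
          omega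
        · exact Or.inr (Or.inr h4)
        · exact Or.inr (Or.inl (Or.inl (Or.inl ⟨i, h7.1, h7.2, h4⟩)))
        · exact Or.inr (Or.inl (Or.inl (Or.inr h4)))
        · exact Or.inr (Or.inl (Or.inr h4))
    · have hd : Disjoint (branch R.T p (z (n + 3)) ∪ branch R.T p (z 1) ∪
          span R.T p z 2 (n + 1)) (branch R.T p (z (n + 2))) :=
        Set.disjoint_union_left.2 ⟨Set.disjoint_union_left.2 ⟨d3.symm, d1⟩, s2⟩
      have hd' := (Set.disjoint_union_left.1 hd).1
      have hW := ((hS 0 t h1 q₃ hq₃).append hD (hY₁ 0 q₁ hq₁) d2.symm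
        (hleaf (n + 2) (by omega) le_rfl _ hd') h2).append hD hM
        (Set.disjoint_union_left.2 ⟨s3.symm, s1.symm⟩)
        (hleaf (n + 2) (by omega) le_rfl _ hd) h0
      refine ⟨_, hW.colorableBut hD hp (ht (n + 2) (by omega) le_rfl)
        (hsucc (n + 2) (by omega) le_rfl) hd (fun v => ?_) he₂ h3⟩
      rcases hz.cover v with h4 | ⟨i, hi, h4⟩
      · exact Or.inl h4
      · have h5 := hi.1
        have h6 := hi.2
        obtain rfl | h7 | rfl | rfl : i = 1 ∨ (2 ≤ i ∧ i ≤ n + 1) ∨ i = n + 2 ∨ i = n + 3 := by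
          omega
        · exact Or.inr (Or.inl (Or.inl (Or.inr h4)))
        · exact Or.inr (Or.inl (Or.inr ⟨i, h7.1, h7.2, h4⟩))
        · exact Or.inr (Or.inr h4)
        · exact Or.inr (Or.inl (Or.inl (Or.inl h4)))

end Frame
end HalinColoring

namespace HalinColoring
namespace Frame

variable {V : Type*} {G : SimpleGraph V} {R : Frame G} {D : Digraph V}

/-! ### Colouring of wheels -/

/-- `T₇` contains walks of each length `≥ 2` between different vertices, with arbitrary directions
of the arcs. -/
theorem exists_walk_ne (s : ℕ → Bool) (n : ℕ) {u v : ZMod 7} (h : v ≠ u) :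
    ∃ g : ℕ → ZMod 7, g 0 = u ∧ g (n + 2) = v ∧ ∀ i < n + 2, Step (s i) (g i) (g (i + 1)) := by
  induction n generalizing s u with
  | zero =>
    obtain ⟨t, h1, h2⟩ := exists_step_step (s 0) (s 1) h
    refine ⟨fun i => if i = 0 then u else if i = 1 then t else v, rfl, rfl, fun i hi => ?_⟩
    obtain rfl | rfl : i = 0 ∨ i = 1 := by omega
    · exact h1
    · exact h2
  | succ n ih =>
    obtain ⟨t, h1, h2, -⟩ := exists_step_avoiding (s 0) u v v
    obtain ⟨g, rfl, h4, h5⟩ := ih (fun i => s (i + 1)) h2.symm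
    refine ⟨fun i => Nat.casesOn i u g, rfl, h4, fun i hi => ?_⟩
    cases i with
    | zero => exact h1
    | succ i => exact h5 i (by omega)

/-- `T₇` contains closed walks of each length `≥ 3`, with arbitrary directions of the arcs. -/
theorem exists_closed_walk (s : ℕ → Bool) (n : ℕ) :
    ∃ g : ℕ → ZMod 7, g (n + 3) = g 0 ∧ ∀ i < n + 3, Step (s i) (g i) (g (i + 1)) := by
  obtain ⟨t, h1, h2, -⟩ := exists_step_avoiding (s 0) 0 0 0
  obtain ⟨g, rfl, h4, h5⟩ := exists_walk_ne (fun i => s (i + 1)) n h2.symm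
  refine ⟨fun i => Nat.casesOn i 0 g, h4, fun i hi => ?_⟩
  cases i with
  | zero => exact h1
  | succ i => exact h5 i (by omega)

/-- The tree is a star with centre `p`. -/
structure IsStar (R : Frame G) (p : V) : Prop where
  inner : ¬ IsLeaf R.T p
  leaf : ∀ w, R.T.Adj p w → IsLeaf R.T w

namespace IsStar

variable {p y : V} {k : ℕ} {z : ℕ → V}

theorem branch_eq (h : R.IsStar p) {w : V} (hw : R.T.Adj p w) : branch R.T p w = {w} :=
  branch_leaf R.isTree hw (h.leaf w hw)

theorem first_eq (h : R.IsStar p) {w : V} (hw : R.T.Adj p w) : R.first p w = w :=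
  R.first_leaf p w hw (h.leaf w hw)

theorem succ_eq (h : R.IsStar p) (hz : R.CyclicOrder p y k z) (i : ℕ) :
    R.succ (z i) = z (i + 1) := by
  rw [← R.first_of_leaf _ _ (hz.adj i).symm (h.leaf _ (hz.adj i)), hz.first_symm h.inner,
    h.first_eq (hz.adj _)]

theorem exists_eq (h : R.IsStar p) (hz : R.CyclicOrder p y k z) {v : V} (hv : v ≠ p) :
    ∃ i < k, z i = v := by
  obtain ⟨i, -, hi⟩ := (hz.cover v).resolve_left hv
  rw [h.branch_eq (hz.adj i)] at hi
  obtain ⟨j, hj, hj'⟩ := hz.surj _ (hz.adj i)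
  exact ⟨j, hj, hj'.trans hi.symm⟩

theorem adj_of_isLeaf (h : R.IsStar p) (hpy : R.T.Adj p y) {w : V} (hw : IsLeaf R.T w) :
    R.T.Adj p w := by
  obtain ⟨k, z, hz⟩ := exists_cyclicOrder h.inner hpy
  obtain ⟨i, -, rfl⟩ := h.exists_eq hz (v := w) (by
    rintro rfl
    exact h.inner hw)
  exact hz.adj i

/-- If the centre of a wheel is a source or a sink, then it gets the additional colour. -/
theorem colorableBut_of_forall (h : R.IsStar p) (hD : D.IsOrientationOf G) {n : ℕ}
    (hz : R.CyclicOrder p y (n + 3) z)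
    (hdir : ∀ w w', R.T.Adj p w → R.T.Adj p w' → dir D p w = dir D p w') :
    ColorableBut D p := by
  obtain ⟨g, hg0, hg⟩ := exists_closed_walk (fun i => dir D (z i) (z (i + 1))) n
  have hidx : ∀ v, v ≠ p → ∃ i < n + 3, z i = v := fun v hv => h.exists_eq hz hv
  classical
  -- the leaf `z i` gets the colour `g i`
  let f : V → ZMod 7 := fun v => if hv : v = p then 0 else g (hidx v hv).choose
  have hf : ∀ i, i < n + 3 → f (z i) = g i := by
    intro i hi
    have hne : z i ≠ p := (hz.adj i).ne'
    have hc := (hidx (z i) hne).choose_spec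
    simp only [f, dif_neg hne]
    rw [hz.inj _ _ hc.1 hi hc.2]
  have hf' : ∀ i, i < n + 3 → f (z (i + 1)) = g (i + 1) := by
    intro i hi
    rcases (Nat.succ_le_of_lt hi).lt_or_eq with hi | hi
    · exact hf _ hi
    · have hi : i + 1 = n + 3 := hi
      rw [hi, hz.last, ← hz.zero, hf 0 (by omega), hg0]
  have hcompat : ∀ i, i < n + 3 → Compat D (z i) (z (i + 1)) (f (z i)) (f (z (i + 1))) := by
    intro i hi
    rw [hf i hi, hf' i hi]
    exact compat_of_step hD.1 (hg i hi)
  refine ⟨f, fun a ha b hb hab => ?_, fun w w' hw hw' => ?_⟩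
  · have hG := adj_of_arc hD hab
    obtain ⟨i, hi, rfl⟩ := hidx a ha
    obtain ⟨j, hj, rfl⟩ := hidx b hb
    have hT : ¬ R.T.Adj (z i) (z j) := fun hT =>
      hb (eq_adj_of_leaf (hz.adj i) (h.leaf _ (hz.adj i)) hT)
    rcases (R.adj _ _ hG hT).2.2 with h1 | h1
    · rw [h.succ_eq hz] at h1
      rw [h1] at hab ⊢
      exact (hcompat i hi).1 hab
    · rw [h.succ_eq hz] at h1
      rw [h1] at hab ⊢
      exact (hcompat j hj).2 hab
  · have hadj : ∀ w, G.Adj p w → R.T.Adj p w := by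
      intro w hw
      by_contra hT
      exact h.inner (R.adj p w hw hT).1
    have h1 := hdir w w' (hadj w (adj_of_arc hD hw).symm) (hadj w' (adj_of_arc hD hw'))
    simp [dir, hD.1 _ _ hw, hw'] at h1

theorem coloredPiece [Finite V] (h : R.IsStar p) (hD : D.IsOrientationOf G)
    (hz : R.CyclicOrder p y k z) (i : ℕ) (c : ZMod 7) {q : ℕ} (hq : q ∈ quads)
    {e : Bool} (he : dir D p (z i) = e) :
    R.ColoredPiece D p (branch R.T p (z i)) (z i) (z i) (z (i + 1)) c
      (signNat e * q) (signNat e * q) := by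
  have hl := h.leaf _ (hz.adj i)
  obtain ⟨e', he', ht⟩ := exists_coloredPiece_thread hD h.inner (.leaf (hz.adj i) hl)
  rw [← he, ← he' hl, ← h.first_eq (hz.adj (i + 1)), ← hz.first_symm h.inner]
  exact ht c q hq

/-- If all other vertices of the wheel are coloured, then the vertex `y` on the external cycle gets
the additional colour. -/
theorem colorableBut [Finite V] (h : R.IsStar p) (hD : D.IsOrientationOf G)
    (hz : R.CyclicOrder p y k z) {W : Set V} {m : V} {c : ZMod 7} {u v : ℕ}
    (hW : R.ColoredPiece D p W (z 1) m y c u v)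
    (hWz : ∀ v, v ∈ W ↔ ∃ i, 1 ≤ i ∧ i < k ∧ z i = v)
    (hn : noConflict (dir D p y) (dir D m y) (dir D y (z 1)) u v = true) :
    ColorableBut D y := by
  have hpy : R.T.Adj p y := hz.zero ▸ hz.adj 0
  refine hW.colorableBut hD h.inner (.leaf hpy (h.leaf y hpy)) ?_ ?_ (fun v => ?_)
    (fun _ => rfl) hn
  · rw [← hz.zero, h.succ_eq hz]
  · rw [h.branch_eq hpy, Set.disjoint_singleton_right, hWz]
    rintro ⟨i, hi, hik, h1⟩
    rw [← hz.zero] at h1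
    have := hz.inj i 0 hik hz.pos h1
    omega
  · by_cases hv : v = p
    · exact Or.inl hv
    obtain ⟨i, hi, rfl⟩ := h.exists_eq hz hv
    by_cases h0 : i = 0
    · rw [h0, hz.zero]
      exact Or.inr (Or.inr (mem_branch_self hpy))
    · exact Or.inr (Or.inl ((hWz _).2 ⟨i, by omega, hi, rfl⟩))

theorem mem_span (h : R.IsStar p) (hz : R.CyclicOrder p y k z) {a b : ℕ} {v : V} :
    v ∈ span R.T p z a b ↔ ∃ i, a ≤ i ∧ i ≤ b ∧ z i = v := by
  refine exists_congr fun i => and_congr_right fun _ => and_congr_right fun _ => ?_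
  rw [h.branch_eq (hz.adj i), Set.mem_singleton_iff, eq_comm]

/-- If some vertex `y` on the external cycle is a source or a sink of this cycle, then it gets the
additional colour. -/
theorem colorableBut_of_ne [Finite V] (h : R.IsStar p) (hD : D.IsOrientationOf G) {n : ℕ}
    (hz : R.CyclicOrder p y (n + 3) z) {x : V} (hx : IsLeaf R.T x) (hxy : R.succ x = y)
    (hne : dir D x y ≠ dir D y (z 1)) : ColorableBut D y := by
  obtain ⟨m, hm⟩ := hz.exists_typedPiece_span hD h.inner (a := 1) (b := n + 2) le_rfl (by omega)
    (by omega) ⟨n + 3, ⟨by omega, le_rfl⟩, Or.inr (by omega)⟩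
  rw [hz.last, h.first_eq (hz.adj 1), h.first_eq (hz.last ▸ hz.adj (n + 3))] at hm
  obtain ⟨α, b, hb, hc⟩ := hm.exists_coloredPiece 0
  have hmx : m = x := R.succ_injOn hm.last_leaf hx (hm.succ_last.trans hxy.symm)
  subst hmx
  refine h.colorableBut hD hz hc (fun v => ?_) ?_
  · rw [h.mem_span hz]
    simp only [Nat.lt_succ_iff]
  · have : ∀ e am al α, ∀ b ∈ units, am ≠ al → noConflict e am al (signNat α) b = true := by
      decide
    exact this _ _ _ _ _ hb hne

/-- If the external cycle of a wheel is a directed cycle and its centre is neither a source nor a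
sink, then some vertex on the external cycle gets the additional colour. -/
theorem exists_colorableBut_of_directed [Finite V] (h : R.IsStar p) (hD : D.IsOrientationOf G)
    {n : ℕ} (hz : R.CyclicOrder p y (n + 3) z) {s : Bool}
    (hs : ∀ w, IsLeaf R.T w → dir D w (R.succ w) = s)
    (h1 : dir D p (z (n + 1)) = s) (h2 : dir D p (z (n + 2)) = !s) : ColorableBut D y := by
  have hs' : ∀ i, dir D (z i) (z (i + 1)) = s := fun i => by
    rw [← h.succ_eq hz]
    exact hs _ (h.leaf _ (hz.adj i))
  have hY : IsLeaf R.T y ∧ y ∉ span R.T p z 1 (n + 2) := by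
    rw [h.mem_span hz]
    refine ⟨hz.zero ▸ h.leaf _ (hz.adj 0), ?_⟩
    rintro ⟨i, h3, h4, h5⟩
    rw [← hz.last] at h5
    exact hz.ne_of_lt (by omega) h3 le_rfl h5
  have a0 : dir D y (z 1) = s := by
    rw [← hs' 0, hz.zero]
  have am : dir D (z (n + 2)) y = s := by
    rw [← hs' (n + 2), hz.last]
  have d : Disjoint (branch R.T p (z (n + 1))) (branch R.T p (z (n + 2))) :=
    hz.branch_disjoint ⟨by omega, by omega⟩ ⟨by omega, by omega⟩ (by omega)
  rcases Nat.eq_zero_or_pos n with rfl | hn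
  · have hc := star_check_three
    simp only [List.all_eq_true, List.any_eq_true, Bool.and_eq_true] at hc
    obtain ⟨q₁, hq₁, q₂, hq₂, h3, h4⟩ := hc s (mem_signs _) (dir D p y) (mem_signs _)
    have hset : branch R.T p (z 1) ∪ branch R.T p (z 2) = span R.T p z 1 2 := by
      rw [span_succ _ _ _ le_rfl, span_self]
    have hW := (h.coloredPiece hD hz 1 0 hq₁ h1).append hD (h.coloredPiece hD hz 2 0 hq₂ h2) d
      ⟨y, hY.1, by rw [hset]; exact hY.2⟩ (by rw [hs' 1]; exact h3)
    rw [hset, hz.last] at hW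
    refine h.colorableBut hD hz hW (fun v => ?_) (by rw [am, a0]; exact h4)
    rw [h.mem_span hz]
    simp only [Nat.lt_succ_iff]
  · have hc := star_check
    simp only [List.all_eq_true, List.any_eq_true, Bool.and_eq_true] at hc
    obtain ⟨m, hm⟩ := hz.exists_typedPiece_span hD h.inner (a := 1) (b := n) le_rfl hn
      (by omega) ⟨n + 3, ⟨by omega, le_rfl⟩, Or.inr (by omega)⟩
    rw [h.first_eq (hz.adj 1), h.first_eq (hz.adj (n + 1))] at hm
    have hmn : m = z n := R.succ_injOn hm.last_leaf (h.leaf _ (hz.adj n))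
      (hm.succ_last.trans (h.succ_eq hz n).symm)
    subst hmn
    obtain ⟨α, b, hb, hM⟩ := hm.exists_coloredPiece 0
    obtain ⟨q₁, hq₁, h0, q₂, hq₂, h3, h4⟩ :=
      hc s (mem_signs _) (dir D p y) (mem_signs _) α (mem_signs _) b hb
    have hset : span R.T p z 1 n ∪ branch R.T p (z (n + 1)) = span R.T p z 1 (n + 1) := by
      rw [span_succ _ _ _ hn]
    have hset' : span R.T p z 1 (n + 1) ∪ branch R.T p (z (n + 2)) = span R.T p z 1 (n + 2) :=
      (span_succ _ _ _ (by omega)).symm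
    have hY' : y ∉ span R.T p z 1 (n + 1) := fun h5 => hY.2 (hset' ▸ Or.inl h5)
    have hW := hM.append hD (h.coloredPiece hD hz (n + 1) 0 hq₁ h1)
      (hz.span_disjoint le_rfl (by omega) ⟨by omega, by omega⟩ (by omega))
      ⟨y, hY.1, by rwa [hset]⟩ (by rw [hs' n]; exact h0)
    rw [hset] at hW
    have hW' := hW.append hD (h.coloredPiece hD hz (n + 2) 0 hq₂ h2)
      (hz.span_disjoint le_rfl (by omega) ⟨by omega, by omega⟩ (by omega))
      ⟨y, hY.1, by rw [hset']; exact hY.2⟩ (by rw [hs' (n + 1)]; exact h3)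
    rw [hset', hz.last] at hW'
    refine h.colorableBut hD hz hW' (fun v => ?_) (by rw [am, a0]; exact h4)
    rw [h.mem_span hz]
    simp only [Nat.lt_succ_iff]

end IsStar

/-- Every orientation of a wheel has a suitable vertex for the additional colour. -/
theorem IsStar.exists_colorableBut [Finite V] {p : V} (h : R.IsStar p)
    (hD : D.IsOrientationOf G) {y a b : V} (hy : R.T.Adj p y) (ha : R.T.Adj p a)
    (hb : R.T.Adj p b) (hay : a ≠ y) (hby : b ≠ y) (hab : a ≠ b) :
    ∃ y, ColorableBut D y := by
  -- the number of neighbours does not depend on where the enumeration starts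
  have hcyc : ∀ x, R.T.Adj p x → ∃ n z, R.CyclicOrder p x (n + 3) z := by
    intro x hx
    obtain ⟨k, z, hz⟩ := exists_cyclicOrder h.inner hx
    have h3 : 3 ≤ k := by
      by_cases hax : a = x
      · subst hax
        exact hz.three_le hy hb hay.symm hab.symm hby.symm
      · by_cases hbx : b = x
        · subst hbx
          exact hz.three_le hy ha hby.symm hax hay.symm
        · exact hz.three_le ha hb hax hbx hab
    obtain ⟨n, rfl⟩ := Nat.exists_eq_add_of_le' h3
    exact ⟨n, z, hz⟩
  have hyl := h.leaf y hy
  have hadj : ∀ {w}, IsLeaf R.T w → R.T.Adj p w := fun hw => h.adj_of_isLeaf hy hw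
  -- a property of leaves that is passed on to the next leaf holds for all leaves
  have hind : ∀ P : V → Prop, (∀ w, IsLeaf R.T w → P w → P (R.succ w)) →
      ∀ w w', IsLeaf R.T w → P w → IsLeaf R.T w' → P w' := by
    intro P hP w w' hw hPw hw'
    obtain ⟨k, rfl⟩ := R.succ_cyclic w w' hw hw'
    clear hw'
    have : ∀ k, IsLeaf R.T (R.succ^[k] w) ∧ P (R.succ^[k] w) := by
      intro k
      induction k with
      | zero => exact ⟨hw, hPw⟩
      | succ k ih =>
        rw [Function.iterate_succ_apply']
        exact ⟨R.succ_leaf _ ih.1, hP _ ih.1 ih.2⟩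
    exact (this k).2
  by_cases hdir : ∀ w w', R.T.Adj p w → R.T.Adj p w' → dir D p w = dir D p w'
  · obtain ⟨n, z, hz⟩ := hcyc y hy
    exact ⟨p, h.colorableBut_of_forall hD hz hdir⟩
  by_cases hrim : ∀ w, IsLeaf R.T w →
      dir D w (R.succ w) = dir D (R.succ w) (R.succ (R.succ w))
  · have hs : ∀ w, IsLeaf R.T w → dir D w (R.succ w) = dir D y (R.succ y) := fun w hw =>
      hind (fun w => dir D w (R.succ w) = dir D y (R.succ y))
        (fun w hw h1 => (hrim w hw).symm.trans h1) y w hyl rfl hw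
    generalize dir D y (R.succ y) = s at hs
    -- since the spokes do not all have the same direction, the direction changes from `s` to `!s`
    -- somewhere on the external cycle
    obtain ⟨w, hw, h1, h2⟩ : ∃ w, IsLeaf R.T w ∧ dir D p w = s ∧
        dir D p (R.succ w) = !s := by
      by_contra! hno
      have hstep := fun w w' hw h1 hw' => hind (fun w => dir D p w = s) (fun w hw h1 => by
        have := hno w hw h1
        rcases s with _ | _ <;> simpa using this) w w' hw h1 hw'
      refine hdir fun w w' hw hw' => ?_
      have hw := h.leaf w hw
      have hw' := h.leaf w' hw'
      by_cases h1 : dir D p w = s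
      · rw [h1, hstep w w' hw h1 hw']
      · have h2 : dir D p w' ≠ s := fun h2 => h1 (hstep w' w hw' h2 hw)
        rw [Bool.eq_not.2 h1, Bool.eq_not.2 h2]
    have hw1 := R.succ_leaf w hw
    have hw2 := R.succ_leaf _ hw1
    obtain ⟨n, z, hz⟩ := hcyc _ (hadj hw2)
    have e2 : z (n + 2) = R.succ w := R.succ_injOn (h.leaf _ (hz.adj _)) hw1 (by
      rw [h.succ_eq hz, hz.last])
    have e1 : z (n + 1) = w := R.succ_injOn (h.leaf _ (hz.adj _)) hw (by
      rw [h.succ_eq hz, e2])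
    exact ⟨_, h.exists_colorableBut_of_directed hD hz hs (by rw [e1, h1]) (by rw [e2, h2])⟩
  · push Not at hrim
    obtain ⟨w, hw, hne⟩ := hrim
    have hw1 := R.succ_leaf w hw
    obtain ⟨n, z, hz⟩ := hcyc _ (hadj hw1)
    refine ⟨_, h.colorableBut_of_ne hD hz hw rfl ?_⟩
    rwa [← h.succ_eq hz 0, hz.zero]

/-- Every orientation of a Halin graph has a suitable vertex for the additional colour. -/
theorem exists_colorableBut [Finite V] (R : Frame G) (hD : D.IsOrientationOf G) :
    ∃ y, ColorableBut D y := by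
  obtain ⟨p, y, a, b, hp, hy, ha, hb, hay, hby, hab, hthread⟩ := R.exists_hub
  by_cases hyl : IsLeaf R.T y
  · by_cases hstar : ∀ w, R.T.Adj p w → IsLeaf R.T w
    · exact IsStar.exists_colorableBut ⟨hp, hstar⟩ hD hy ha hb hay hby hab
    · push Not at hstar
      obtain ⟨x, hx, hxl⟩ := hstar
      have ht : ∀ w, R.T.Adj p w → w ≠ x → ∃ y, IsThread R.T p w y := by
        intro w hw _
        by_cases hwy : w = y
        · exact ⟨w, .leaf hw (hwy ▸ hyl)⟩
        · exact hthread w hw hwy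
      have hyx : y ≠ x := by
        rintro rfl
        exact hxl hyl
      by_cases hax : a = x
      · subst hax
        exact exists_colorableBut_of_inner hD hp hxl hx hy hb hyx hab.symm hby.symm ht
      · exact exists_colorableBut_of_inner hD hp hxl hx hy ha hyx hax hay.symm ht
  · exact exists_colorableBut_of_inner hD hp hyl hy ha hb hay hby hab hthread

end Frame
end HalinColoring

namespace HalinColoring
open SimpleGraph

/-! ### Faces of Halin graphs -/


variable {V : Type u} {G : SimpleGraph V}

/-- The embedding `R` with the external face `F₀` shows that `G` is a Halin graph. -/
structure IsHalinEmbedding (R : RotationSystem G) (F₀ : R.Face) : Prop where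
  planar : R.IsPlanar
  isTree : (G.deleteEdges (R.faceEdges F₀)).IsTree
  three_leaves : 3 ≤ (G.deleteEdges (R.faceEdges F₀)).leaves.ncard
  leaves_eq : (G.deleteEdges (R.faceEdges F₀)).leaves = R.faceVerts F₀

theorem isLeaf_iff_mem_leaves {T : SimpleGraph V} {v : V} : IsLeaf T v ↔ v ∈ T.leaves := by
  show _ ↔ (T.neighborSet v).ncard = 1
  rw [Set.ncard_eq_one]
  refine exists_congr fun p => ?_
  rw [Set.ext_iff]
  exact Iff.rfl

theorem facePerm_apply (R : RotationSystem G) (d : G.Dart) : R.facePerm d = R.rot d.symm := rfl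

theorem rot_fst (R : RotationSystem G) (d : G.Dart) : (R.rot d).fst = d.fst :=
  (R.isCycleOn d.fst).1.mapsTo (show d.fst = d.fst from rfl)

theorem facePerm_fst (R : RotationSystem G) (d : G.Dart) : (R.facePerm d).fst = d.snd := by
  rw [facePerm_apply, rot_fst]
  rfl

theorem face_facePerm (R : RotationSystem G) (d : G.Dart) : R.face (R.facePerm d) = R.face d :=
  Quotient.sound (s := Equiv.Perm.SameCycle.setoid R.facePerm)
    (Equiv.Perm.sameCycle_apply_left.2 (Equiv.Perm.SameCycle.refl _ _))

theorem face_eq_iff (R : RotationSystem G) (d d' : G.Dart) :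
    R.face d = R.face d' ↔ R.facePerm.SameCycle d d' :=
  Quotient.eq (r := Equiv.Perm.SameCycle.setoid R.facePerm)

theorem rot_ne_self (R : RotationSystem G) {d d' : G.Dart} (h : d ≠ d') (hd : d.fst = d'.fst) :
    R.rot d ≠ d :=
  (R.isCycleOn d.fst).apply_ne ⟨d, rfl, d', hd.symm, h⟩ rfl

theorem dart_ext {d d' : G.Dart} (h1 : d.fst = d'.fst) (h2 : d.snd = d'.snd) : d = d' :=
  Dart.ext _ _ (Prod.ext h1 h2)

namespace IsHalinEmbedding

variable {R : RotationSystem G} {F₀ : R.Face}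

/-- The tree of a Halin graph. -/
abbrev tree (R : RotationSystem G) (F₀ : R.Face) : SimpleGraph V :=
  G.deleteEdges (R.faceEdges F₀)

/-- The dart belongs to an edge of the external cycle. -/
def IsRim (R : RotationSystem G) (F₀ : R.Face) (d : G.Dart) : Prop := d.edge ∈ R.faceEdges F₀

theorem tree_adj_iff (d : G.Dart) : (tree R F₀).Adj d.fst d.snd ↔ ¬ IsRim R F₀ d := by
  rw [SimpleGraph.deleteEdges_adj]
  exact and_iff_right d.adj

theorem isRim_of_face {d : G.Dart} (h : R.face d = F₀) : IsRim R F₀ d := ⟨d, h, rfl⟩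

theorem IsRim.symm {d : G.Dart} (h : IsRim R F₀ d) : IsRim R F₀ d.symm := by
  rwa [IsRim, Dart.edge_symm]

theorem IsRim.face_symm {d : G.Dart} (h : IsRim R F₀ d) (hd : R.face d ≠ F₀) :
    R.face d.symm = F₀ := by
  obtain ⟨d', h1, h2⟩ := h
  rcases (dart_edge_eq_iff d' d).1 h2 with rfl | rfl
  · exact absurd h1 hd
  · exact h1

section

variable (h : IsHalinEmbedding R F₀)
include h

theorem isLeaf_of_face {d : G.Dart} (hd : R.face d = F₀) : IsLeaf (tree R F₀) d.fst := by
  rw [isLeaf_iff_mem_leaves, h.leaves_eq]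
  exact ⟨d, hd, rfl⟩

theorem isLeaf_of_isRim {d : G.Dart} (hd : IsRim R F₀ d) : IsLeaf (tree R F₀) d.fst := by
  by_cases hf : R.face d = F₀
  · exact h.isLeaf_of_face hf
  · have h1 := hd.face_symm hf
    rw [← face_facePerm] at h1
    have h2 := h.isLeaf_of_face h1
    rwa [facePerm_fst] at h2

theorem exists_dart_of_isLeaf {v : V} (hv : IsLeaf (tree R F₀) v) :
    ∃ d : G.Dart, R.face d = F₀ ∧ d.fst = v := by
  rw [isLeaf_iff_mem_leaves, h.leaves_eq] at hv
  exact hv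

/-- No vertex of `G` has only one neighbour, so that face-tracing walks do not turn back. -/
theorem rot_ne_self_of_not_isRim {d : G.Dart} (hd : ¬ IsRim R F₀ d) : R.rot d ≠ d := by
  by_cases hl : IsLeaf (tree R F₀) d.fst
  · obtain ⟨d', h1, h2⟩ := h.exists_dart_of_isLeaf hl
    refine rot_ne_self R (d' := d') ?_ h2.symm
    rintro rfl
    exact hd (isRim_of_face h1)
  · have hd' := (tree_adj_iff d).2 hd
    obtain ⟨w, hw, hne⟩ : ∃ w, (tree R F₀).Adj d.fst w ∧ w ≠ d.snd := by
      by_contra! hno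
      exact hl ⟨d.snd, fun w => ⟨hno w, fun hw => hw ▸ hd'⟩⟩
    refine rot_ne_self R (d' := ⟨(d.fst, w), (SimpleGraph.deleteEdges_le _) hw⟩) ?_ rfl
    intro he
    exact hne (congrArg (fun d : G.Dart => d.snd) he).symm

/-- The boundary of each face contains an edge of the external cycle. Otherwise it would be a closed
walk in the tree that never turns back. -/
theorem exists_isRim [Finite V] (d : G.Dart) : ∃ d', R.face d' = R.face d ∧ IsRim R F₀ d' := by
  classical
  by_contra! hno
  have hface : ∀ n : ℕ, R.face ((R.facePerm ^ n) d) = R.face d := by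
    intro n
    induction n with
    | zero => rfl
    | succ n ih =>
      rw [pow_succ', Equiv.Perm.mul_apply, face_facePerm, ih]
  have hrim : ∀ n : ℕ, ¬ IsRim R F₀ ((R.facePerm ^ n) d) := fun n => hno _ (hface n)
  have hadj : ∀ n : ℕ, (tree R F₀).Adj ((R.facePerm ^ n) d).fst ((R.facePerm ^ (n + 1)) d).fst := by
    intro n
    rw [pow_succ' _ n, Equiv.Perm.mul_apply, facePerm_fst]
    exact (tree_adj_iff _).2 (hrim n)
  have hne : ∀ n : ℕ, ((R.facePerm ^ (n + 2)) d).fst ≠ ((R.facePerm ^ n) d).fst := by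
    intro n he
    have h1 : (R.facePerm ^ (n + 1)) d = R.rot ((R.facePerm ^ n) d).symm := by
      rw [pow_succ' _ n, Equiv.Perm.mul_apply, facePerm_apply]
    have h2 : ((R.facePerm ^ (n + 2)) d).fst = ((R.facePerm ^ (n + 1)) d).snd := by
      rw [pow_succ' _ (n + 1), Equiv.Perm.mul_apply, facePerm_fst]
    refine h.rot_ne_self_of_not_isRim (d := ((R.facePerm ^ n) d).symm)
      (fun h3 => hrim n (by simpa using h3.symm)) (dart_ext (rot_fst R _) ?_)
    rw [← h1, ← h2, he]
    rfl
  have hdist : ∀ n : ℕ, (tree R F₀).dist d.fst ((R.facePerm ^ n) d).fst = n ∧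
      (tree R F₀).dist d.fst ((R.facePerm ^ (n + 1)) d).fst = n + 1 := by
    intro n
    induction n with
    | zero => exact ⟨SimpleGraph.dist_self, SimpleGraph.dist_eq_one_iff_adj.2 (hadj 0)⟩
    | succ n ih =>
      refine ⟨ih.2, ?_⟩
      rcases h.isTree.dist_eq_dist_add_one_of_adj d.fst (hadj (n + 1)) with h1 | h1
      · refine absurd (eq_of_dist_add_one h.isTree (hadj (n + 1)).symm (hadj n) h1.symm ?_) (hne n)
        rw [ih.1, ih.2]
      · rw [h1, ih.2]
  obtain ⟨n, hn, hn'⟩ : ∃ n : ℕ, 0 < n ∧ (R.facePerm ^ n) d = d := by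
    have : Finite G.Dart := Finite.of_injective Dart.toProd fun a b h => Dart.ext a b h
    exact ⟨orderOf R.facePerm, orderOf_pos _, by rw [pow_orderOf_eq_one]; rfl⟩
  have := (hdist n).1
  rw [hn', SimpleGraph.dist_self] at this
  omega

/-- By Euler's formula, there is one face more than there are edges on the external cycle. -/
theorem card_face [Finite V] : Nat.card R.Face = (R.faceEdges F₀).ncard + 1 := by
  classical
  have := Fintype.ofFinite V
  have h1 := h.planar.2
  have h2 := h.isTree.card_edgeFinset
  have h3 : (G.deleteEdges (R.faceEdges F₀)).edgeSet = G.edgeSet \ R.faceEdges F₀ :=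
    SimpleGraph.edgeSet_deleteEdges _
  have h4 : R.faceEdges F₀ ⊆ G.edgeSet := by
    rintro _ ⟨d, -, rfl⟩
    exact d.edge_mem
  have h5 := Set.ncard_sdiff_add_ncard_of_subset h4 (Set.toFinite _)
  rw [← h3, ← SimpleGraph.coe_edgeFinset, Set.ncard_coe_finset] at h5
  rw [← Nat.card_coe_set_eq G.edgeSet] at h5
  rw [Nat.card_eq_fintype_card (α := V)] at h1
  omega

end

end IsHalinEmbedding
end HalinColoring

namespace HalinColoring
open SimpleGraph


variable {V : Type u} {G : SimpleGraph V}

namespace IsHalinEmbedding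

variable {R : RotationSystem G} {F₀ : R.Face}

/-- The faces on the other sides of the edges of the external cycle are different from each other
and from the external face: there are as many such edges as inner faces, and each inner face is
reached. -/
theorem exists_outer_dart [Finite V] (h : IsHalinEmbedding R F₀) :
    ∃ o : R.faceEdges F₀ → G.Dart, (∀ e, R.face (o e) = F₀ ∧ (o e).edge = e) ∧
      (∀ e, R.face (o e).symm ≠ F₀) ∧ Function.Injective fun e => R.face (o e).symm := by
  classical
  have hdart : Finite G.Dart := Finite.of_injective Dart.toProd fun a b h => Dart.ext a b h
  have hfin : Finite R.Face := Finite.of_surjective R.face Quotient.mk_surjective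
  choose o ho using fun e : R.faceEdges F₀ => e.2
  have hsub : {F | F ≠ F₀} ⊆ Set.range fun e => R.face (o e).symm := by
    intro F hF
    obtain ⟨d, rfl⟩ := Quotient.mk_surjective F
    obtain ⟨d', h1, h2⟩ := h.exists_isRim d
    have h3 : R.face d' ≠ F₀ := by
      rw [h1]
      exact hF
    refine ⟨⟨d'.edge, h2⟩, Eq.trans ?_ h1⟩
    rcases (dart_edge_eq_iff _ d').1 (ho ⟨d'.edge, h2⟩).2 with h4 | h4
    · exact absurd (h4 ▸ (ho ⟨d'.edge, h2⟩).1) h3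
    · show R.face (o ⟨d'.edge, h2⟩).symm = _
      rw [h4, Dart.symm_symm]
  have hcard : {F | F ≠ F₀}.ncard = (R.faceEdges F₀).ncard := by
    have h1 := Set.ncard_add_ncard_compl ({F₀} : Set R.Face)
    rw [Set.ncard_singleton, h.card_face] at h1
    have h2 : {F | F ≠ F₀} = ({F₀} : Set R.Face)ᶜ := rfl
    rw [h2]
    omega
  rw [← Set.image_univ] at hsub
  have hle : ((fun e => R.face (o e).symm) '' Set.univ).ncard ≤ (R.faceEdges F₀).ncard := by
    refine (Set.ncard_image_le (Set.toFinite _)).trans ?_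
    rw [Set.ncard_univ, Nat.card_coe_set_eq]
  have himage := Set.eq_of_subset_of_ncard_le hsub (hcard ▸ hle) (Set.toFinite _)
  refine ⟨o, ho, fun e => ?_, ?_⟩
  · have : R.face (o e).symm ∈ {F | F ≠ F₀} := himage ▸ Set.mem_image_of_mem _ (Set.mem_univ e)
    exact this
  · refine Set.injOn_univ.1 ((Set.ncard_image_iff (Set.toFinite _)).1 ?_)
    rw [← himage, hcard, Set.ncard_univ, Nat.card_coe_set_eq]

theorem face_symm_ne [Finite V] (h : IsHalinEmbedding R F₀) {d : G.Dart} (hd : R.face d = F₀) :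
    R.face d.symm ≠ F₀ := by
  obtain ⟨o, ho, hne, -⟩ := h.exists_outer_dart
  have h1 := hne ⟨d.edge, isRim_of_face hd⟩
  rcases (dart_edge_eq_iff _ d).1 (ho ⟨d.edge, isRim_of_face hd⟩).2 with h4 | h4
  · rwa [h4] at h1
  · rw [h4, Dart.symm_symm] at h1
    exact absurd hd h1

/-- Each inner face has only one edge on the external cycle. -/
theorem eq_of_face_eq [Finite V] (h : IsHalinEmbedding R F₀) {d d' : G.Dart} (hd : IsRim R F₀ d)
    (hd' : IsRim R F₀ d') (hne : R.face d ≠ F₀) (he : R.face d = R.face d') : d = d' := by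
  obtain ⟨o, ho, -, hinj⟩ := h.exists_outer_dart
  have key : ∀ d : G.Dart, ∀ hd : IsRim R F₀ d, R.face d ≠ F₀ → (o ⟨d.edge, hd⟩).symm = d := by
    intro d hd hne
    rcases (dart_edge_eq_iff _ d).1 (ho ⟨d.edge, hd⟩).2 with h4 | h4
    · exact absurd (h4 ▸ (ho ⟨d.edge, hd⟩).1) hne
    · rw [h4, Dart.symm_symm]
  have h1 := key d hd hne
  have h2 := key d' hd' (he ▸ hne)
  have h3 := @hinj ⟨d.edge, hd⟩ ⟨d'.edge, hd'⟩ (by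
    show R.face (o _).symm = R.face (o _).symm
    rw [h1, h2, he])
  rw [← h1, ← h2, h3]

/-! ### The darts at a leaf -/

theorem face_rot (d : G.Dart) : R.face (R.rot d) = R.face d.symm := by
  rw [← face_facePerm R d.symm, facePerm_apply, Dart.symm_symm]

/-- The dart that leaves a leaf on the external face is followed by the dart of the tree. -/
theorem not_isRim_rot [Finite V] (h : IsHalinEmbedding R F₀) {d : G.Dart} (hd : R.face d = F₀) :
    ¬ IsRim R F₀ (R.rot d) := by
  intro hr
  have hne : R.face d.symm ≠ F₀ := h.face_symm_ne hd
  have hface : R.face (R.rot d) = R.face d.symm := face_rot d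
  have h1 := h.eq_of_face_eq hr (isRim_of_face hd).symm (hface ▸ hne) hface
  have h2 := congrArg (fun d : G.Dart => d.fst) h1
  simp only [rot_fst] at h2
  exact d.adj.ne h2

theorem eq_of_not_isRim {d d' : G.Dart} (hl : IsLeaf (tree R F₀) d.fst) (hf : d.fst = d'.fst)
    (hd : ¬ IsRim R F₀ d) (hd' : ¬ IsRim R F₀ d') : d = d' := by
  obtain ⟨p, hp⟩ := hl
  have h1 := (hp _).1 ((tree_adj_iff d).2 hd)
  have h2 := (hp _).1 (hf ▸ (tree_adj_iff d').2 hd')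
  exact dart_ext hf (h1.trans h2.symm)

/-- Only one dart of the external face leaves a vertex. -/
theorem eq_of_face_of_fst_eq [Finite V] (h : IsHalinEmbedding R F₀) {d d' : G.Dart}
    (hd : R.face d = F₀) (hd' : R.face d' = F₀) (hf : d.fst = d'.fst) : d = d' := by
  refine R.rot.injective (eq_of_not_isRim ?_ ?_ (h.not_isRim_rot hd) (h.not_isRim_rot hd'))
  · rw [rot_fst]
    exact h.isLeaf_of_face hd
  · rw [rot_fst, rot_fst, hf]

/-- The dart of the tree at a leaf is followed by the dart that leads backwards on the external
face. -/
theorem face_symm_rot [Finite V] (h : IsHalinEmbedding R F₀) {d : G.Dart}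
    (hl : IsLeaf (tree R F₀) d.fst) (hd : ¬ IsRim R F₀ d) :
    IsRim R F₀ (R.rot d) ∧ R.face (R.rot d).symm = F₀ := by
  have hr : IsRim R F₀ (R.rot d) := by
    by_contra hr
    exact h.rot_ne_self_of_not_isRim hd
      (eq_of_not_isRim (by rwa [rot_fst]) (rot_fst R d) hr hd)
  refine ⟨hr, hr.face_symm fun h1 => hd ?_⟩
  have h2 : R.face d.symm = F₀ := by
    rw [← h1, face_rot]
  simpa using (isRim_of_face h2).symm

open Classical in
/-- The leaf that follows `v` on the external face. -/
noncomputable def succ (R : RotationSystem G) (F₀ : R.Face) (v : V) : V :=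
  if hv : ∃ d : G.Dart, R.face d = F₀ ∧ d.fst = v then hv.choose.snd else v

theorem succ_fst [Finite V] (h : IsHalinEmbedding R F₀) {d : G.Dart} (hd : R.face d = F₀) :
    succ R F₀ d.fst = d.snd := by
  have hv : ∃ d' : G.Dart, R.face d' = F₀ ∧ d'.fst = d.fst := ⟨d, hd, rfl⟩
  rw [succ, dif_pos hv, h.eq_of_face_of_fst_eq hv.choose_spec.1 hd hv.choose_spec.2]

open Classical in
/-- The neighbour that follows `y` in the rotation around `x`. -/
noncomputable def next (R : RotationSystem G) (x y : V) : V :=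
  if hxy : G.Adj x y then (R.rot ⟨(x, y), hxy⟩).snd else y

theorem next_eq (d : G.Dart) : next R d.fst d.snd = (R.rot d).snd := by
  rw [next, dif_pos d.adj]

theorem next_iterate (d : G.Dart) (k : ℕ) :
    (next R d.fst)^[k] d.snd = ((R.rot ^ k) d).snd ∧ ((R.rot ^ k) d).fst = d.fst := by
  induction k with
  | zero => exact ⟨rfl, rfl⟩
  | succ k ih =>
    rw [Function.iterate_succ_apply', ih.1, pow_succ', Equiv.Perm.mul_apply, rot_fst]
    refine ⟨?_, ih.2⟩
    rw [← next_eq, ih.2]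

open Classical in
/-- The first leaf of the branch at the edge `c x`: the vertex where the dart of the external cycle
that is on the same face as the dart `(c, x)` starts. -/
noncomputable def first (R : RotationSystem G) (F₀ : R.Face) (c x : V) : V :=
  if hc : ∃ d d' : G.Dart, d.fst = c ∧ d.snd = x ∧ R.face d' = R.face d ∧ IsRim R F₀ d' then
    hc.choose_spec.choose.fst
  else x

theorem first_eq [Finite V] (h : IsHalinEmbedding R F₀) {d d' : G.Dart} (hd : ¬ IsRim R F₀ d)
    (hf : R.face d' = R.face d) (hd' : IsRim R F₀ d') : first R F₀ d.fst d.snd = d'.fst := by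
  have hc : ∃ e e' : G.Dart, e.fst = d.fst ∧ e.snd = d.snd ∧ R.face e' = R.face e ∧
    IsRim R F₀ e' := ⟨d, d', rfl, rfl, hf, hd'⟩
  rw [first, dif_pos hc]
  obtain ⟨h1, h2, h3, h4⟩ := hc.choose_spec.choose_spec
  have h5 := h3.trans (congrArg R.face (dart_ext h1 h2))
  have hne : R.face d' ≠ F₀ := fun h6 => hd (isRim_of_face (hf.symm.trans h6))
  exact congrArg (fun d : G.Dart => d.fst) (h.eq_of_face_eq hd' h4 hne (hf.trans h5.symm)).symm

/-- All edges at an inner vertex belong to the tree. -/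
theorem not_isRim_of_not_isLeaf (h : IsHalinEmbedding R F₀) {d : G.Dart}
    (hd : ¬ IsLeaf (tree R F₀) d.fst) : ¬ IsRim R F₀ d := fun hr => hd (h.isLeaf_of_isRim hr)

theorem succ_adj [Finite V] (h : IsHalinEmbedding R F₀) {u : V} (hu : IsLeaf (tree R F₀) u) :
    IsLeaf (tree R F₀) (succ R F₀ u) ∧ G.Adj u (succ R F₀ u) := by
  obtain ⟨d, hd, rfl⟩ := h.exists_dart_of_isLeaf hu
  rw [h.succ_fst hd]
  refine ⟨?_, d.adj⟩
  rw [← facePerm_fst R]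
  exact h.isLeaf_of_face ((face_facePerm R d).trans hd)

/-- The boundary walk of the external face passes through all leaves. -/
theorem succ_cyclic [Finite V] (h : IsHalinEmbedding R F₀) {u v : V}
    (hu : IsLeaf (tree R F₀) u) (hv : IsLeaf (tree R F₀) v) : ∃ k, (succ R F₀)^[k] u = v := by
  have hdart : Finite G.Dart := Finite.of_injective Dart.toProd fun a b h => Dart.ext a b h
  obtain ⟨d, hd, rfl⟩ := h.exists_dart_of_isLeaf hu
  obtain ⟨d', hd', rfl⟩ := h.exists_dart_of_isLeaf hv
  obtain ⟨k, hk⟩ := ((face_eq_iff R d d').1 (hd.trans hd'.symm)).exists_nat_pow_eq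
  have key : ∀ k : ℕ, (succ R F₀)^[k] d.fst = ((R.facePerm ^ k) d).fst ∧
      R.face ((R.facePerm ^ k) d) = F₀ := by
    intro k
    induction k with
    | zero => exact ⟨rfl, hd⟩
    | succ k ih =>
      rw [Function.iterate_succ_apply', ih.1, pow_succ', Equiv.Perm.mul_apply, face_facePerm,
        facePerm_fst]
      exact ⟨h.succ_fst ih.2, ih.2⟩
  exact ⟨k, (key k).1.trans (by rw [hk])⟩

theorem eq_succ_of_isRim [Finite V] (h : IsHalinEmbedding R F₀) {d : G.Dart}
    (hd : IsRim R F₀ d) : d.snd = succ R F₀ d.fst ∨ d.fst = succ R F₀ d.snd := by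
  by_cases hf : R.face d = F₀
  · exact Or.inl (h.succ_fst hf).symm
  · exact Or.inr (h.succ_fst (hd.face_symm hf)).symm

/-- At a leaf `x`, the walk around the face of the dart `(c, x)` goes on along the external cycle.
-/
theorem first_leaf [Finite V] (h : IsHalinEmbedding R F₀) {d : G.Dart} (hd : ¬ IsRim R F₀ d)
    (hl : IsLeaf (tree R F₀) d.snd) : first R F₀ d.fst d.snd = d.snd := by
  have hd' : ¬ IsRim R F₀ d.symm := fun h1 => hd (by simpa using h1.symm)
  rw [h.first_eq hd (face_facePerm R d) (h.face_symm_rot hl hd').1, facePerm_fst]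

/-- At an inner vertex `x`, the walk around the face of the dart `(c, x)` goes on to the next
neighbour of `x`. -/
theorem first_inner [Finite V] (h : IsHalinEmbedding R F₀) {d : G.Dart} (hd : ¬ IsRim R F₀ d)
    (hl : ¬ IsLeaf (tree R F₀) d.snd) :
    first R F₀ d.fst d.snd = first R F₀ d.snd (next R d.snd d.fst) := by
  obtain ⟨d', h1, h2⟩ := h.exists_isRim d
  have h3 : (R.facePerm d).fst = d.snd := facePerm_fst R d
  have h4 : (R.facePerm d).snd = next R d.snd d.fst := (next_eq (R := R) d.symm).symm
  rw [h.first_eq hd h1 h2, ← h4, ← h3,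
    h.first_eq (h.not_isRim_of_not_isLeaf (by rwa [h3])) (h1.trans (face_facePerm R d).symm) h2]

/-- At a leaf `c`, the walk around the face of the dart `(c, x)` comes from the next leaf. -/
theorem first_of_leaf [Finite V] (h : IsHalinEmbedding R F₀) {d : G.Dart} (hd : ¬ IsRim R F₀ d)
    (hl : IsLeaf (tree R F₀) d.fst) : first R F₀ d.fst d.snd = succ R F₀ d.fst := by
  obtain ⟨o, ho, hof⟩ := h.exists_dart_of_isLeaf hl
  have h1 : R.rot o = d :=
    eq_of_not_isRim (by rwa [rot_fst, hof]) (by rw [rot_fst, hof]) (h.not_isRim_rot ho) hd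
  rw [h.first_eq hd (d' := o.symm) (by rw [← h1, face_rot]) (isRim_of_face ho).symm, ← hof,
    h.succ_fst ho]
  rfl

/-- The combinatorial description of a Halin graph by its embedding. -/
noncomputable def frame [Finite V] (h : IsHalinEmbedding R F₀) : Frame G where
  T := tree R F₀
  isTree := h.isTree
  le := SimpleGraph.deleteEdges_le _
  next := next R
  next_adj := by
    intro x y hx hxy
    let d : G.Dart := ⟨(x, y), SimpleGraph.deleteEdges_le _ hxy⟩
    have h1 : (R.rot d).fst = x := rot_fst R d
    have h2 : ¬ IsRim R F₀ (R.rot d) := h.not_isRim_of_not_isLeaf (by rwa [h1])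
    have h3 := (tree_adj_iff _).2 h2
    rwa [h1, ← next_eq] at h3
  next_cyclic := by
    intro x y z hx hy hz
    have hdart : Finite G.Dart := Finite.of_injective Dart.toProd fun a b h => Dart.ext a b h
    let d : G.Dart := ⟨(x, y), SimpleGraph.deleteEdges_le _ hy⟩
    let d' : G.Dart := ⟨(x, z), SimpleGraph.deleteEdges_le _ hz⟩
    obtain ⟨k, hk⟩ := ((R.isCycleOn x).2 (show d.fst = x from rfl)
      (show d'.fst = x from rfl)).exists_nat_pow_eq
    exact ⟨k, (next_iterate d k).1.trans (by rw [hk])⟩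
  succ := succ R F₀
  succ_leaf := fun u hu => (h.succ_adj hu).1
  succ_adj := fun u hu => (h.succ_adj hu).2
  succ_cyclic := fun u v hu hv => h.succ_cyclic hu hv
  adj := by
    intro u v huv hT
    let d : G.Dart := ⟨(u, v), huv⟩
    have hd : IsRim R F₀ d := by
      by_contra hd
      exact hT ((tree_adj_iff d).2 hd)
    exact ⟨h.isLeaf_of_isRim hd, h.isLeaf_of_isRim hd.symm, h.eq_succ_of_isRim hd⟩
  first := first R F₀
  first_leaf := fun c x hcx hx =>
    h.first_leaf (d := ⟨(c, x), SimpleGraph.deleteEdges_le _ hcx⟩) ((tree_adj_iff _).1 hcx) hx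
  first_inner := fun c x hcx hx =>
    h.first_inner (d := ⟨(c, x), SimpleGraph.deleteEdges_le _ hcx⟩) ((tree_adj_iff _).1 hcx) hx
  first_of_leaf := fun c x hcx hc =>
    h.first_of_leaf (d := ⟨(c, x), SimpleGraph.deleteEdges_le _ hcx⟩) ((tree_adj_iff _).1 hcx) hc
  three_leaves := by
    have : {v | IsLeaf (tree R F₀) v} = (tree R F₀).leaves :=
      Set.ext fun v => isLeaf_iff_mem_leaves
    rw [this]
    exact h.three_leaves

end IsHalinEmbedding
end HalinColoring

namespace HalinColoring
open SimpleGraph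

/-! ### The oriented chromatic number of Halin graphs -/

theorem orientedColorable_mono {V : Type*} {D : Digraph V} {k l : ℕ} (hkl : k ≤ l)
    (h : D.OrientedColorable k) : D.OrientedColorable l := by
  obtain ⟨β, h1, h2⟩ := h
  have hinj := Fin.castLE_injective hkl
  exact ⟨fun v => Fin.castLE hkl (β v), fun u v huv he => h1 u v huv (hinj he),
    fun t u v w htu hvw => (h2 t u v w htu hvw).imp (fun h he => h (hinj he))
      fun h he => h (hinj he)⟩

theorem IsHalin.exists_hom {V : Type*} {G : SimpleGraph V} {D : Digraph V} (hG : G.IsHalin)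
    (hD : D.IsOrientationOf G) : D.OrientedColorable 8 ∧
      ∃ H : Digraph (Option (ZMod 7)), H.IsOriented ∧
        (∀ i j : ZMod 7, H.Adj (some i) (some j) ↔ Digraph.T7.Adj i j) ∧
        Nonempty (D.Adj →r H.Adj) := by
  obtain ⟨hV, R, hR, F₀, hT, h3, hl⟩ := hG
  have h : IsHalinEmbedding R F₀ := ⟨hR, hT, h3, hl⟩
  obtain ⟨y, hy⟩ := h.frame.exists_colorableBut hD
  obtain ⟨H, hH, hT7, ⟨g⟩⟩ := hy.exists_hom hD.1
  exact ⟨orientedColorable_of_hom hH g (by simp [ZMod.card]), H, hH, hT7, ⟨g⟩⟩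

theorem IsHalin.orientedChromaticNumber_le {V : Type*} {G : SimpleGraph V} {D : Digraph V}
    (hG : G.IsHalin) (hD : D.IsOrientationOf G) : D.orientedChromaticNumber ≤ 8 :=
  iInf₂_le 8 (IsHalin.exists_hom hG hD).1

theorem exDigraph_isOrientationOf : exDigraph.IsOrientationOf exGraph :=
  ⟨exDigraph_isOriented, rfl⟩

theorem exDigraph_orientedChromaticNumber : exDigraph.orientedChromaticNumber = 8 := by
  refine le_antisymm
    (IsHalin.orientedChromaticNumber_le exGraph_isHalin exDigraph_isOrientationOf) ?_
  refine le_iInf₂ fun k hk => ?_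
  by_contra hlt
  have hlt : k < 8 := by
    rw [not_le] at hlt
    exact_mod_cast hlt
  exact exDigraph_not_colorable (orientedColorable_mono (Nat.le_of_lt_succ hlt) hk)

end HalinColoring

theorem mainTheorem1 :
    -- every oriented Halin graph has an oriented colouring with 8 colours, and it even has
    -- a homomorphism to an oriented graph consisting of `T₇` and one further vertex
    (∀ (V : Type u) (G : SimpleGraph V) (D : Digraph V), G.IsHalin → D.IsOrientationOf G →
      D.OrientedColorable 8 ∧
      ∃ H : Digraph (Option (ZMod 7)), H.IsOriented ∧
        (∀ i j : ZMod 7, H.Adj (some i) (some j) ↔ Digraph.T7.Adj i j) ∧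
        Nonempty (D.Adj →r H.Adj)) ∧
    -- some oriented Halin graph needs 8 colours
    (∃ (n : ℕ) (G : SimpleGraph (Fin n)) (D : Digraph (Fin n)),
      G.IsHalin ∧ D.IsOrientationOf G ∧ D.orientedChromaticNumber = 8) ∧
    -- the oriented chromatic number of the family of Halin graphs is 8
    SimpleGraph.familyOrientedChromaticNumber.{0} SimpleGraph.IsHalin = 8 := by
  refine ⟨fun V G D hG hD => HalinColoring.IsHalin.exists_hom hG hD,
    ⟨29, HalinColoring.exGraph, HalinColoring.exDigraph, HalinColoring.exGraph_isHalin,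
      HalinColoring.exDigraph_isOrientationOf, HalinColoring.exDigraph_orientedChromaticNumber⟩, ?_⟩
  refine le_antisymm ?_ ?_
  · exact iSup_le fun V => iSup₂_le fun G hG => iSup₂_le fun D hD =>
      HalinColoring.IsHalin.orientedChromaticNumber_le hG hD
  · rw [← HalinColoring.exDigraph_orientedChromaticNumber]
    refine le_trans ?_ (le_iSup _ (Fin 29))
    refine le_trans ?_ (le_iSup₂ HalinColoring.exGraph HalinColoring.exGraph_isHalin)
    exact le_iSup₂ (f := fun (D : Digraph (Fin 29))
      (_ : D.IsOrientationOf HalinColoring.exGraph) => D.orientedChromaticNumber)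
      HalinColoring.exDigraph HalinColoring.exDigraph_isOrientationOf
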